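/- Let $(W,S)$ be a Coxeter system with $S$ finite, with Coxeter matrix $(m(s,t))$ ($m(s,t)=\infty$ allowed), and let $\Gamma$ be its Coxeter diagram: the graph on $S$ with $s\neq t$ joined when $m(s,t)\ge 3$. Let $V=\mathbb{R}^{S}$ have basis the simple roots $\Delta=\{\alpha_s: s\in S\}$, with bilinear form $(\alpha_s,\alpha_t)=-\cos(\pi/m(s,t))$, and let $W$ act on $V$ by $s(v)=v-2(v,\alpha_s)\alpha_s$. Let $\Phi=\{w(\alpha_s)\}$ be the root system, $\Phi^+$ the set of roots with nonnegative coordinates in $\Delta$, and $M_\Phi$ the oriented matroid of the vector configuration $\Phi^+\subset V$; its covectors are the sign vectors $(\operatorname{sign} f(\alpha))_{\alpha\in\Phi^+}$, $f\in V^*$. A flat of $M_\Phi$ is positive if it is the zero set of a covector with all entries in $\{+,0\}$. For $J\subseteq S$ let $\Phi_J^+$ be the set of positive roots in the span of $\{\alpha_s:s\in J\}$, and $\Gamma_J$ the induced subgraph of $\Gamma$ on $J$. A matroid is connected if its ground set is nonempty and any two distinct elements are linked by a chain of elements, consecutive ones lying in a common circuit; a flat is connected if the restriction of the matroid to it is.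 A tube of $\Gamma$ is a nonempty proper subset $J\subsetneq S$ with $\Gamma_J$ connected. A base $B$ of a matroid on $E$ is circuitous if every connected flat spanned by a subset of $B$ with at least two elements is spanned by the basic circuit $C(B,e)$ (the unique circuit contained in $B\cup\{e\}$) of some $e\in E\setminus B$. Let $R=\{f\in V^*: f(\alpha_s)\ge 0 \text{ for all } s\in S\}$ and let $T=\bigcup_{w\in W}w(R)\subset V^*$ be the Tits cone; a flat $F$ of $M_\Phi$ is parabolic if $X_F\cap T$ spans $X_F$, where $X_F=\{f\in V^*: f(\alpha)=0 \text{ for all } \alpha\in F\}$. Then the following hold. (i) $J\mapsto\Phi_J^+$ is a bijection from the subsets $J\subseteq S$ to the positive flats of $M_\Phi$, and, if $W$ is infinite, every positive flat is parabolic. (ii) $J\mapsto\Phi_J^+$ restricts to a bijection from the nonempty $J\subseteq S$ with $\Gamma_J$ connected to the connected positive flats of $M_\Phi$; under it the tubes of $\Gamma$ correspond exactly to the connected positive flats other than $\Phi^+$. (iii) $\Delta$ is a circuitous base of $M_\Phi$. (iv) Let $F\subsetneq G$ be flats of $M_\Phi$, assumed to be parabolic if $W$ is infinite. If $G$ is connected,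 then the matroid quotient $G/F$ (the restriction of $M_\Phi$ to $G$, contracted by $F$) is connected. -/

import Mathlib

noncomputable section

open Set

namespace CoxeterFlats

/-! ### Matroids -/

section Matroids

variable {α V : Type*} [AddCommGroup V] [Module ℝ V]

/-- The matroid represented by a set `E` of vectors: its ground set is `E` and its independent
sets are the linearly independent subsets of `E`. -/
def vectorMatroid (E : Set V) : Matroid V :=
  (IndepMatroid.ofFinitary E (fun I => I ⊆ E ∧ LinearIndepOn ℝ id I)
    ⟨empty_subset E, linearIndepOn_empty ℝ id⟩
    (fun _ _ hJ hIJ => ⟨hIJ.trans hJ.1, hJ.2.mono hIJ⟩)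
    (by
      rintro I B ⟨hIE, hI⟩ hImax hB
      by_contra! hcon
      apply hImax
      -- every element of `B` lies in the span of `I`
      have hBI : B ⊆ (Submodule.span ℝ I : Set V) := by
        intro x hx
        by_contra hxI
        have hxI' : x ∉ I := fun h => hxI (Submodule.subset_span h)
        exact hcon x ⟨hx, hxI'⟩ (insert_subset (hB.1.1 hx) hIE) (hI.id_insert hxI)
      -- every element of `E` lies in the span of `B`
      have hEB : E ⊆ (Submodule.span ℝ B : Set V) := by
        intro x hx
        by_contra hxB
        have := hB.2 (y := insert x B)
          ⟨insert_subset hx hB.1.1, hB.1.2.id_insert hxB⟩ (subset_insert x B)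
        exact hxB (Submodule.subset_span (this (mem_insert x B)))
      refine ⟨⟨hIE, hI⟩, fun J hJ hIJ x hx => ?_⟩
      by_contra hxI
      have hspan : x ∈ Submodule.span ℝ I := Submodule.span_le.2 hBI (hEB (hJ.1 hx))
      have hins : LinearIndepOn ℝ id (insert x I) := hJ.2.mono (insert_subset hx hIJ)
      exact ((linearIndepOn_id_insert hxI).1 hins).2 hspan)
    (fun I h =>
      ⟨fun x hx => (h {x} (singleton_subset_iff.2 hx) (finite_singleton x)).1 rfl,
        linearIndepOn_of_finite I fun J hJ hJfin => (h J hJ hJfin).2⟩)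
    (fun _ hI => hI.1)).matroid

/-- A matroid is connected if it has exactly one connected component: its ground set is nonempty,
and any two of its elements are related by the reflexive and transitive closure of the relation
"lie in a common circuit". -/
def MatroidConnected (M : Matroid α) : Prop :=
  M.E.Nonempty ∧ ∀ e ∈ M.E, ∀ f ∈ M.E,
    Relation.ReflTransGen (fun x y => ∃ C, M.IsCircuit C ∧ x ∈ C ∧ y ∈ C) e f

/-- A base `B` is circuitous if every connected flat spanned by a subset of `B` with at least two
elements is spanned by the basic circuit of some `e ∈ E \ B` with respect to `B`.
(A flat spanned by one element of `B` is of rank one, so it is never spanned by a basic circuit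
in a matroid without loops and parallel elements.) -/
def IsCircuitousBase (M : Matroid α) (B : Set α) : Prop :=
  M.IsBase B ∧ ∀ I ⊆ B, I.Nontrivial → MatroidConnected (M.restrict (M.closure I)) →
    ∃ e ∈ M.E \ B, M.closure (M.fundCircuit e B) = M.closure I

end Matroids

/-! ### Graphs -/

/-- A tube of a graph: a proper nonempty set of nodes whose induced subgraph is connected. -/
def IsTube {B : Type*} (Γ : SimpleGraph B) (J : Set B) : Prop :=
  J ≠ univ ∧ J.Nonempty ∧ (Γ.induce J).Connected

/-! ### The geometric representation of a Coxeter system -/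

section Geometric

variable {B : Type*} (M : CoxeterMatrix B)

/-- The Coxeter diagram, without labels: `s` and `t` are joined when `m(s,t) ≥ 3`
(`M s t = 0` encodes `m(s,t) = ∞`). -/
def diagram : SimpleGraph B where
  Adj s t := s ≠ t ∧ (3 ≤ M s t ∨ M s t = 0)
  symm := ⟨fun s t h => ⟨h.1.symm, by rw [M.symmetric t s]; exact h.2⟩⟩
  loopless := ⟨fun _ h => h.1 rfl⟩

/-- The simple root `α_s`, a vector of the standard basis of `ℝ^S`. -/
def simpleRoot (s : B) : B →₀ ℝ := Finsupp.single s 1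

/-- The bilinear form with `(α_s, α_t) = - cos (π / m(s,t))`.  When `m(s,t) = ∞`, encoded as
`M s t = 0`, the value is `- cos 0 = - 1`, as `π / 0 = 0`. -/
def form : (B →₀ ℝ) →ₗ[ℝ] (B →₀ ℝ) →ₗ[ℝ] ℝ :=
  Finsupp.linearCombination ℝ fun s =>
    Finsupp.linearCombination ℝ fun t => -Real.cos (Real.pi / (M s t : ℝ))

theorem form_simpleRoot (s t : B) :
    form M (simpleRoot s) (simpleRoot t) = -Real.cos (Real.pi / (M s t : ℝ)) := by
  simp [form, simpleRoot]

/-- The linear functional `v ↦ 2 (v, α_s)`. -/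
def simpleCoroot (s : B) : Module.Dual ℝ (B →₀ ℝ) := (2 : ℝ) • (form M).flip (simpleRoot s)

theorem simpleCoroot_apply (s : B) (v : B →₀ ℝ) :
    simpleCoroot M s v = 2 * form M v (simpleRoot s) := by
  simp [simpleCoroot]

theorem simpleCoroot_simpleRoot (s : B) : simpleCoroot M s (simpleRoot s) = 2 := by
  rw [simpleCoroot_apply, form_simpleRoot, M.diagonal]
  simp

/-- The reflection `v ↦ v - 2 (v, α_s) α_s`. -/
def simpleReflection (s : B) : (B →₀ ℝ) ≃ₗ[ℝ] (B →₀ ℝ) :=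
  Module.reflection (simpleCoroot_simpleRoot M s)

theorem simpleReflection_apply (s : B) (v : B →₀ ℝ) :
    simpleReflection M s v = v - (2 * form M v (simpleRoot s)) • simpleRoot s := by
  rw [simpleReflection, Module.reflection_apply, simpleCoroot_apply]

/-- The simple reflections satisfy the Coxeter relations. -/
theorem isLiftable_simpleReflection : M.IsLiftable (simpleReflection M) := by
  intro s t
  by_cases hst : s = t
  · subst hst
    rw [M.diagonal, pow_one]
    ext1 v
    exact Module.involutive_reflection (simpleCoroot_simpleRoot M s) v
  have h1 : M s t ≠ 1 := M.off_diagonal s t hst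
  generalize hm : M s t = m at h1
  have hm' : M t s = m := by rw [M.symmetric t s]; exact hm
  have hfy : simpleCoroot M s (simpleRoot t) = -2 * Real.cos (Real.pi / m) := by
    rw [simpleCoroot_apply, form_simpleRoot, hm']; ring
  have hgx : simpleCoroot M t (simpleRoot s) = -2 * Real.cos (Real.pi / m) := by
    rw [simpleCoroot_apply, form_simpleRoot, hm]; ring
  obtain rfl | h0 := Nat.eq_zero_or_pos m
  · exact pow_zero _
  have hmpos : (0 : ℝ) < m := by exact_mod_cast h0
  ext1 z
  rw [simpleReflection, simpleReflection,
    Module.reflection_mul_reflection_pow_apply _ _ m z (2 * Real.cos (2 * (Real.pi / m)))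
      (by rw [hfy, hgx, Real.cos_two_mul]; ring)]
  change _ = z
  set φ : ℝ := 2 * (Real.pi / m) with hφ
  have hmφ : (m : ℝ) * φ = 2 * Real.pi := by rw [hφ]; field_simp
  obtain rfl | h2 : m = 2 ∨ 3 ≤ m := by omega
  · rw [hfy, hgx]
    have hc : Real.cos (Real.pi / (2 : ℕ)) = 0 := by
      rw [Nat.cast_ofNat, Real.cos_pi_div_two]
    have hcφ : Real.cos φ = -1 := by
      rw [hφ, Nat.cast_ofNat, mul_div_cancel₀ _ (two_ne_zero' ℝ), Real.cos_pi]
    rw [hc, hcφ]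
    norm_num
    module
  have h3 : (3 : ℝ) ≤ m := by exact_mod_cast h2
  have hsin : Real.sin φ ≠ 0 := by
    apply ne_of_gt
    apply Real.sin_pos_of_pos_of_lt_pi
    · positivity
    · have := Real.pi_pos
      nlinarith
  have hS (k : ℤ) := Polynomial.Chebyshev.S_two_mul_real_cos φ k
  obtain ⟨k, hk⟩ | ⟨k, hk⟩ := Nat.even_or_odd m
  · have e1 : ((m : ℤ) - 2) / 2 = k - 1 := by omega
    have e2 : ((m : ℤ) - 1) / 2 = k - 1 := by omega
    have hz : (Polynomial.Chebyshev.S ℝ (k - 1)).eval (2 * Real.cos φ) = 0 := by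
      have := hS (k - 1)
      have hkφ : (((k - 1 : ℤ) : ℝ) + 1) * φ = Real.pi := by
        have : (m : ℝ) = k + k := by exact_mod_cast hk
        push_cast
        rw [this] at hmφ
        linarith
      rw [hkφ, Real.sin_pi] at this
      exact (mul_eq_zero.1 this).resolve_right hsin
    rw [e1, e2, hz]
    simp
  · have e1 : ((m : ℤ) - 2) / 2 = k - 1 := by omega
    have e2 : ((m : ℤ) - 1) / 2 = k := by omega
    have e3 : ((m : ℤ) - 3) / 2 = k - 1 := by omega
    have e4 : (m : ℤ) / 2 = k := by omega
    have hz : (Polynomial.Chebyshev.S ℝ k).eval (2 * Real.cos φ) +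
        (Polynomial.Chebyshev.S ℝ (k - 1)).eval (2 * Real.cos φ) = 0 := by
      have ha := hS k
      have hb := hS (k - 1)
      have hkφ : (((k : ℤ) : ℝ) + 1) * φ = 2 * Real.pi - (((k - 1 : ℤ) : ℝ) + 1) * φ := by
        have : (m : ℝ) = 2 * k + 1 := by exact_mod_cast hk
        push_cast
        rw [this] at hmφ
        linarith
      rw [hkφ, Real.sin_two_pi_sub, ← hb] at ha
      apply (mul_eq_zero.1 _).resolve_right hsin
      linarith
    rw [e1, e2, e3, e4, hz]
    simp

end Geometric

/-! ### Roots, the matroid of the positive roots, the Tits cone and parabolic flats -/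

section System

variable {B : Type*} {M : CoxeterMatrix B} {W : Type*} [Group W] (cs : CoxeterSystem M W)

/-- The geometric representation of `W` on `V = ℝ^S`, in which `s` acts by the reflection
`v ↦ v - 2 (v, α_s) α_s`. -/
def geometricRep : W →* ((B →₀ ℝ) ≃ₗ[ℝ] (B →₀ ℝ)) :=
  cs.lift ⟨simpleReflection M, isLiftable_simpleReflection M⟩

theorem geometricRep_simple (s : B) : geometricRep cs (cs.simple s) = simpleReflection M s :=
  cs.lift_apply_simple (isLiftable_simpleReflection M) s

/-- The root system `Φ = {w(α_s)}`. -/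
def roots : Set (B →₀ ℝ) := {v | ∃ (w : W) (s : B), v = geometricRep cs w (simpleRoot s)}

/-- The positive roots: the roots with nonnegative coordinates in the basis of simple roots. -/
def posRoots : Set (B →₀ ℝ) := {v | v ∈ roots cs ∧ ∀ s, 0 ≤ v s}

/-- The matroid `M_Φ`, represented by the vector configuration of positive roots. -/
def rootMatroid : Matroid (B →₀ ℝ) := vectorMatroid (posRoots cs)

/-- The covectors of the oriented matroid `M_Φ`: the sign vectors
`(sign f(α))_{α ∈ Φ⁺}` of the linear functionals `f` on `V`. -/
def covectors : Set (posRoots cs → SignType) :=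
  range fun (f : Module.Dual ℝ (B →₀ ℝ)) (a : posRoots cs) => SignType.sign (f a)

/-- A positive flat: a flat of `M_Φ` which is the zero set of a covector all of whose entries
are `+` or `0`. -/
def IsPositiveFlat (F : Set (B →₀ ℝ)) : Prop :=
  (rootMatroid cs).IsFlat F ∧
    ∃ X ∈ covectors cs, (∀ a, X a = 1 ∨ X a = 0) ∧ F = Subtype.val '' {a | X a = 0}

/-- The standard parabolic flat `Φ_J⁺`: the positive roots in the span of `{α_s : s ∈ J}`. -/
def standardFlat (J : Set B) : Set (B →₀ ℝ) :=
  {v | v ∈ posRoots cs ∧ v ∈ Submodule.span ℝ (simpleRoot '' J)}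

/-- The Tits cone `T = ⋃ w(R)` in the dual space `V*`, on which `W` acts by
`(w f)(v) = f (w⁻¹ v)`; here `R` is the closed fundamental chamber, that is, the cone of
nonnegative combinations of the basis dual to the simple roots. -/
def titsCone : Set (Module.Dual ℝ (B →₀ ℝ)) :=
  {f | ∃ (w : W) (g : Module.Dual ℝ (B →₀ ℝ)), (∀ s, 0 ≤ g (simpleRoot s)) ∧
    ∀ v, f v = g (geometricRep cs w⁻¹ v)}

/-- The intersection subspace `X_F` of the hyperplanes `H_α = {f : f(α) = 0}`, `α ∈ F`. -/
def flatSpace (F : Set (B →₀ ℝ)) : Submodule ℝ (Module.Dual ℝ (B →₀ ℝ)) :=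
  Submodule.dualAnnihilator (Submodule.span ℝ F)

/-- A parabolic flat: a flat `F` of `M_Φ` for which the convex cone `X_F ∩ T` has full dimension
in `X_F`, that is, spans `X_F`. -/
def IsParabolicFlat (F : Set (B →₀ ℝ)) : Prop :=
  (rootMatroid cs).IsFlat F ∧
    Submodule.span ℝ ((flatSpace F : Set (Module.Dual ℝ (B →₀ ℝ))) ∩ titsCone cs) = flatSpace F

/-- The flats under consideration: all flats of `M_Φ` when `W` is finite, and the parabolic flats
when `W` is infinite. -/
def IsCoxeterFlat (F : Set (B →₀ ℝ)) : Prop :=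
  (rootMatroid cs).IsFlat F ∧ (Infinite W → IsParabolicFlat cs F)

/-- A flat is connected if the restriction of the matroid `M_Φ` to it is connected. -/
def IsConnectedFlat (F : Set (B →₀ ℝ)) : Prop :=
  MatroidConnected ((rootMatroid cs).restrict F)

/-- The matroid quotient `G / F`: restrict `M_Φ` to `G`, then contract `F`. -/
def flatQuotient (G F : Set (B →₀ ℝ)) : Matroid (B →₀ ℝ) :=
  ((rootMatroid cs).restrict G).contract F

end System

end CoxeterFlats

end

/-! A nonempty matroid of nonzero vectors is connected iff the vectors cannot be distributed
nontrivially over two independent subspaces (`MatroidConnected.subset_or_subset`,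
`matroidConnected_of_subset_or_subset`). `IndecomposableMod P E` is this condition modulo a subspace
`P`; taking for `P` the span of a flat F, it yields connectedness of the quotient by F.

Every root is positive or negative. A functional that is nonnegative on Δ vanishes on exactly those
positive roots that are supported on its zero simple roots, so the positive flats are the Φ_J⁺. They
are parabolic because coordinate functionals lie in the fundamental chamber. This is (i).

If Γ_K is connected, some positive root has support exactly K (`exists_mem_posRoots_support_eq`).
This root drags all simple roots of K into whichever of two subspaces contains it, so Φ_K⁺ is
indecomposable modulo the span of any Δ_J (`indecomposableMod_standardFlat`). If Γ_K is
disconnected, the roots of Φ_K⁺ split accordingly (`mem_span_or_mem_span_of_not_adj`). Together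
these give (ii). The basic circuit of the same root consists of the root and Δ_K, which gives (iii).

For (iv), a parabolic flat, or any flat if W is finite, is the set of positive roots killed by a
functional that is negative on only finitely many positive roots. Such a functional can be reflected
into the fundamental chamber, since each reflection in a simple root where it is negative lowers
their number. Hence the spans of F ⊂ G are conjugate, simultaneously, to spans of Δ_J and Δ_K
(`exists_map_eq_span_of_le`). Connectedness of G then says that Γ_K is connected, and
indecomposability modulo the span of Δ_J is carried back. -/

noncomputable section

open Set

namespace CoxeterFlats

/-! ### Connectedness of represented matroids as indecomposability -/

section VectorMatroid

variable {α V : Type*} [AddCommGroup V] [Module ℝ V]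

theorem vectorMatroid_indep_iff {E I : Set V} :
    (vectorMatroid E).Indep I ↔ I ⊆ E ∧ LinearIndepOn ℝ id I := by
  simp [vectorMatroid, IndepMatroid.ofFinitary]

theorem mem_closure_vectorMatroid_iff {E X : Set V} (hX : X ⊆ E) {e : V} :
    e ∈ (vectorMatroid E).closure X ↔ e ∈ E ∧ e ∈ Submodule.span ℝ X := by
  obtain ⟨I, hI⟩ := (vectorMatroid E).exists_isBasis X hX
  have hIi := vectorMatroid_indep_iff.1 hI.indep
  have hspan : Submodule.span ℝ I = Submodule.span ℝ X := by
    refine le_antisymm (Submodule.span_mono hI.subset) (Submodule.span_le.2 fun x hx => ?_)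
    by_contra hxI
    have hxI' : x ∉ I := fun h => hxI (Submodule.subset_span h)
    have := hI.insert_dep ⟨hx, hxI'⟩
    exact this.not_indep (vectorMatroid_indep_iff.2
      ⟨insert_subset (hX hx) hIi.1, hIi.2.id_insert hxI⟩)
  rw [← hI.closure_eq_closure, hI.indep.mem_closure_iff', ← hspan]
  refine and_congr_right fun he => ⟨fun h => ?_, fun h hins => ?_⟩
  · by_contra hn
    exact hn (Submodule.subset_span (h (vectorMatroid_indep_iff.2
      ⟨insert_subset he hIi.1, hIi.2.id_insert hn⟩)))
  · by_contra hn
    exact ((linearIndepOn_id_insert hn).1 (vectorMatroid_indep_iff.1 hins).2).2 h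

theorem isFlat_vectorMatroid_iff {E F : Set V} :
    (vectorMatroid E).IsFlat F ↔ F ⊆ E ∧ ∀ e ∈ E, e ∈ Submodule.span ℝ F → e ∈ F := by
  constructor
  · intro h
    have hF : F ⊆ E := h.subset_ground
    refine ⟨hF, fun e he hs => ?_⟩
    rw [← h.closure]
    exact (mem_closure_vectorMatroid_iff hF).2 ⟨he, hs⟩
  · rintro ⟨hF, h⟩
    rw [Matroid.isFlat_iff_closure_eq]
    ext e
    rw [mem_closure_vectorMatroid_iff hF]
    exact ⟨fun he => h e he.1 he.2, fun he => ⟨hF he, Submodule.subset_span he⟩⟩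

/-- Contracting F amounts to passing to the quotient space by its span: a basis of F has the same
span, and independence over that basis is independence in the quotient. -/
theorem indep_restrict_contract_vectorMatroid_iff {E G F I : Set V} (hGE : G ⊆ E) (hFG : F ⊆ G) :
    (((vectorMatroid E).restrict G).contract F).Indep I ↔
      I ⊆ G \ F ∧ LinearIndepOn ℝ (Submodule.span ℝ F).mkQ I := by
  obtain ⟨K, hK⟩ := ((vectorMatroid E).restrict G).exists_isBasis F hFG
  have hKi := Matroid.restrict_indep_iff.1 hK.indep
  have hKl := (vectorMatroid_indep_iff.1 hKi.1).2
  have hspan : Submodule.span ℝ K = Submodule.span ℝ F := by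
    refine le_antisymm (Submodule.span_mono hK.subset) (Submodule.span_le.2 fun x hx => ?_)
    by_contra hxI
    have hxI' : x ∉ K := fun h => hxI (Submodule.subset_span h)
    have := hK.insert_dep ⟨hx, hxI'⟩
    exact this.not_indep (Matroid.restrict_indep_iff.2 ⟨vectorMatroid_indep_iff.2
      ⟨insert_subset (hGE (hFG hx)) (hKi.2.trans hGE), hKl.id_insert hxI⟩,
      insert_subset (hFG hx) hKi.2⟩)
  rw [hK.contract_indep_iff, Matroid.restrict_indep_iff, vectorMatroid_indep_iff, ← hspan]
  have key (hd : Disjoint F I) : LinearIndepOn ℝ id (I ∪ K) ↔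
      LinearIndepOn ℝ (Submodule.span ℝ K).mkQ I := by
    have := LinearIndepOn.quotient_iff_union hKl (hd.mono_left hK.subset)
    rw [union_comm, ← this, image_id]
    rfl
  constructor
  · rintro ⟨⟨⟨-, hl⟩, hG⟩, hd⟩
    exact ⟨subset_sdiff.2 ⟨subset_union_left.trans hG, hd.symm⟩, (key hd).1 hl⟩
  · rintro ⟨hI, hl⟩
    obtain ⟨hIG, hd⟩ := subset_sdiff.1 hI
    have := union_subset hIG hKi.2
    exact ⟨⟨⟨this.trans hGE, (key hd.symm).2 hl⟩, this⟩, hd.symm⟩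

theorem disjoint_span_image_of_linearIndepOn_union {v : α → V} {s t : Set α}
    (hst : Disjoint s t) (h : LinearIndepOn ℝ v (s ∪ t)) :
    Disjoint (Submodule.span ℝ (v '' s)) (Submodule.span ℝ (v '' t)) :=
  ((linearIndepOn_union_iff hst).1 h).2.2

/-- In a connected matroid represented by the vectors `v e`, the vectors cannot be distributed
over two independent subspaces. -/
theorem MatroidConnected.subset_or_subset {N : Matroid α} {v : α → V}
    (hN : ∀ I, N.Indep I ↔ I ⊆ N.E ∧ LinearIndepOn ℝ v I) (hv : ∀ e ∈ N.E, v e ≠ 0)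
    (hc : MatroidConnected N) {U₁ U₂ : Submodule ℝ V} (hU : Disjoint U₁ U₂)
    (hE : ∀ e ∈ N.E, v e ∈ U₁ ∨ v e ∈ U₂) :
    (∀ e ∈ N.E, v e ∈ U₁) ∨ (∀ e ∈ N.E, v e ∈ U₂) := by
  have hnot : ∀ e ∈ N.E, v e ∈ U₁ → v e ∉ U₂ := fun e he h1 h2 =>
    hv e he (Submodule.disjoint_def.1 hU _ h1 h2)
  have step : ∀ x y, (∃ C, N.IsCircuit C ∧ x ∈ C ∧ y ∈ C) → v x ∈ U₁ → v y ∈ U₁ := by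
    rintro x y ⟨C, hC, hx, hy⟩ hx1
    by_contra hy1
    have hCE := hC.subset_ground
    -- A circuit meeting both subspaces is cut into two proper, hence independent, parts; the
    -- disjointness of the subspaces would make their union independent.
    have hlin (P : α → Prop) (z : α) (hz : z ∈ C) (hPz : ¬ P z) :
        LinearIndepOn ℝ v {c ∈ C | P c} :=
      ((hN _).1 (hC.ssubset_indep ⟨sep_subset _ _, fun h => hPz (h hz).2⟩)).2
    have h1 := hlin (fun c => v c ∈ U₁) y hy hy1
    have h2 := hlin (fun c => v c ∈ U₂) x hx (hnot x (hCE hx) hx1)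
    have hu := h1.union h2 (hU.mono
      (Submodule.span_le.2 (by rintro _ ⟨c, hc, rfl⟩; exact hc.2))
      (Submodule.span_le.2 (by rintro _ ⟨c, hc, rfl⟩; exact hc.2)))
    refine hC.not_indep ((hN C).2 ⟨hCE, hu.mono fun c hc => ?_⟩)
    exact (hE c (hCE hc)).imp (fun h => ⟨hc, h⟩) (fun h => ⟨hc, h⟩)
  by_cases h : ∃ e ∈ N.E, v e ∈ U₁
  · obtain ⟨e, he, he1⟩ := h
    refine Or.inl fun f hf => ?_
    have := hc.2 e he f hf
    induction this using Relation.ReflTransGen.head_induction_on with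
    | refl => exact he1
    | head h _ ih =>
      obtain ⟨C, hC, hx, hy⟩ := h
      exact ih (hC.subset_ground hy) (step _ _ ⟨C, hC, hx, hy⟩ he1)
  · push Not at h
    exact Or.inr fun e he => (hE e he).resolve_left (h e he)

/-- The component `K` of `e` and its complement span independent subspaces: a circuit inside the
union of a basis of each would meet both, and so would link `K` to its complement. -/
theorem matroidConnected_of_subset_or_subset {N : Matroid α} {v : α → V}
    (hN : ∀ I, N.Indep I ↔ I ⊆ N.E ∧ LinearIndepOn ℝ v I) (hv : ∀ e ∈ N.E, v e ≠ 0)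
    (hne : N.E.Nonempty)
    (h : ∀ U₁ U₂ : Submodule ℝ V, Disjoint U₁ U₂ → (∀ e ∈ N.E, v e ∈ U₁ ∨ v e ∈ U₂) →
      (∀ e ∈ N.E, v e ∈ U₁) ∨ (∀ e ∈ N.E, v e ∈ U₂)) :
    MatroidConnected N := by
  refine ⟨hne, fun e he f hf => ?_⟩
  set r : α → α → Prop := fun x y => ∃ C, N.IsCircuit C ∧ x ∈ C ∧ y ∈ C with hr
  set K : Set α := {x | x ∈ N.E ∧ Relation.ReflTransGen r e x} with hK
  obtain ⟨I, hIK, -, hKI, hI⟩ :=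
    exists_linearIndepOn_extension (linearIndepOn_empty ℝ v) (empty_subset K)
  obtain ⟨J, hJK, -, hKJ, hJ⟩ :=
    exists_linearIndepOn_extension (linearIndepOn_empty ℝ v) (empty_subset (N.E \ K))
  have hIE : I ⊆ N.E := hIK.trans fun x hx => hx.1
  have hJE : J ⊆ N.E := hJK.trans sdiff_subset
  have hIJ : Disjoint I J := disjoint_left.2 fun x hx hx' => (hJK hx').2 (hIK hx)
  have hind : N.Indep (I ∪ J) := by
    by_contra hdep
    obtain ⟨C, hCss, hC⟩ := Matroid.Dep.exists_isCircuit_subset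
      (M := N) (X := I ∪ J) ⟨hdep, union_subset hIE hJE⟩
    have hx : ∃ x ∈ C, x ∈ I := by
      by_contra! hn
      exact hC.not_indep (((hN J).2 ⟨hJE, hJ⟩).subset
        fun c hc => (hCss hc).resolve_left (hn c hc))
    have hy : ∃ y ∈ C, y ∈ J := by
      by_contra! hn
      exact hC.not_indep (((hN I).2 ⟨hIE, hI⟩).subset
        fun c hc => (hCss hc).resolve_right (hn c hc))
    obtain ⟨x, hxC, hxI⟩ := hx
    obtain ⟨y, hyC, hyJ⟩ := hy
    exact (hJK hyJ).2 ⟨hJE hyJ, (hIK hxI).2.tail ⟨C, hC, hxC, hyC⟩⟩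
  have hd := disjoint_span_image_of_linearIndepOn_union hIJ ((hN _).1 hind).2
  have heK : e ∈ K := ⟨he, .refl⟩
  rcases h _ _ hd (fun x hx => by
    by_cases hxK : x ∈ K
    · exact Or.inl (hKI (mem_image_of_mem v hxK))
    · exact Or.inr (hKJ (mem_image_of_mem v ⟨hx, hxK⟩))) with h1 | h2
  · by_contra hf'
    have hfK : f ∉ K := fun h => hf' h.2
    exact hv f hf (Submodule.disjoint_def.1 hd _ (h1 f hf)
      (hKJ (mem_image_of_mem v ⟨hf, hfK⟩)))
  · exact absurd (Submodule.disjoint_def.1 hd _ (hKI (mem_image_of_mem v heK)) (h2 e he))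
      (hv e he)

/-- The vectors of `E` span an indecomposable configuration modulo the subspace `P`. -/
def IndecomposableMod (P : Submodule ℝ V) (E : Set V) : Prop :=
  ∀ U₁ U₂ : Submodule ℝ V, P ≤ U₁ → P ≤ U₂ → U₁ ⊓ U₂ ≤ P → (∀ e ∈ E, e ∈ U₁ ∨ e ∈ U₂) →
    (∀ e ∈ E, e ∈ U₁) ∨ (∀ e ∈ E, e ∈ U₂)

/-- Elements of W carry positive roots to positive roots only up to sign; subspaces do not see the
sign. -/
theorem IndecomposableMod.of_equiv {P : Submodule ℝ V} {E E' : Set V}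
    (h : IndecomposableMod P E) (g : V ≃ₗ[ℝ] V) (hE : ∀ e ∈ E, g e ∈ E' ∨ -g e ∈ E')
    (hE' : ∀ e ∈ E', g.symm e ∈ E ∨ -g.symm e ∈ E) :
    IndecomposableMod (P.map (g : V →ₗ[ℝ] V)) E' := by
  intro U₁ U₂ h1 h2 h12 hU
  have key (U : Submodule ℝ V) (hmem : ∀ e ∈ E, e ∈ U.comap (g : V →ₗ[ℝ] V)) :
      ∀ e ∈ E', e ∈ U := by
    intro e he
    rcases hE' e he with h | h
    · simpa using hmem _ h
    · simpa using hmem _ h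
  refine (h (U₁.comap (g : V →ₗ[ℝ] V)) (U₂.comap (g : V →ₗ[ℝ] V))
    (Submodule.map_le_iff_le_comap.1 h1) (Submodule.map_le_iff_le_comap.1 h2)
    (fun x hx => ?_) (fun e he => ?_)).imp (key U₁) (key U₂)
  · obtain ⟨y, hy, hyx⟩ := h12 (show g x ∈ U₁ ⊓ U₂ from hx)
    rwa [← g.injective hyx]
  · rcases hE e he with h | h
    · exact hU _ h
    · simpa using hU _ h

theorem MatroidConnected.indecomposableMod {E F : Set V} (hE : (0 : V) ∉ E) (hF : F ⊆ E)
    (h : MatroidConnected ((vectorMatroid E).restrict F)) :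
    F.Nonempty ∧ IndecomposableMod ⊥ F := by
  refine ⟨h.1, fun U₁ U₂ _ _ h12 hU => ?_⟩
  refine MatroidConnected.subset_or_subset (N := (vectorMatroid E).restrict F) (v := id)
    (fun I => ?_) (fun e he h0 => hE (h0 ▸ hF he)) h (disjoint_iff_inf_le.2 h12) hU
  rw [Matroid.restrict_indep_iff, vectorMatroid_indep_iff]
  exact ⟨fun h => ⟨h.2, h.1.2⟩, fun h => ⟨⟨h.1.trans hF, h.2⟩, h.1⟩⟩

theorem matroidConnected_restrict_contract {E G F : Set V} (hF : (vectorMatroid E).IsFlat F)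
    (hG : G ⊆ E) (hFG : F ⊂ G) (h : IndecomposableMod (Submodule.span ℝ F) G) :
    MatroidConnected (((vectorMatroid E).restrict G).contract F) := by
  refine matroidConnected_of_subset_or_subset (v := (Submodule.span ℝ F).mkQ)
    (fun I => ?_) (fun e he h0 => ?_) ?_ (fun U₁ U₂ hU hE => ?_)
  · exact indep_restrict_contract_vectorMatroid_iff hG hFG.1
  · have he' : e ∈ G \ F := he
    -- Flatness of `F` is what makes the elements outside `F` nonzero modulo its span.
    refine he'.2 ((isFlat_vectorMatroid_iff.1 hF).2 e (hG he'.1) ?_)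
    simpa using h0
  · exact nonempty_of_ssubset hFG
  · have hP (U : Submodule ℝ (V ⧸ Submodule.span ℝ F)) :
        Submodule.span ℝ F ≤ U.comap (Submodule.span ℝ F).mkQ := fun x hx => by
      rw [Submodule.mem_comap, Submodule.mkQ_apply, (Submodule.Quotient.mk_eq_zero _).2 hx]
      exact U.zero_mem
    refine (h (U₁.comap (Submodule.span ℝ F).mkQ) (U₂.comap (Submodule.span ℝ F).mkQ)
      (hP U₁) (hP U₂) (fun x hx => ?_) (fun e he => ?_)).imp
      (fun h e he => h e he.1) (fun h e he => h e he.1)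
    · exact (Submodule.Quotient.mk_eq_zero _).1 (Submodule.disjoint_def.1 hU _ hx.1 hx.2)
    · by_cases heF : e ∈ F
      · exact Or.inl (hP U₁ (Submodule.subset_span heF))
      · exact hE e ⟨he, heF⟩

end VectorMatroid

/-! ### The bilinear form and the simple reflections -/

section Form

variable {B : Type*} (M : CoxeterMatrix B)

theorem form_simpleRoot_self (s : B) : form M (simpleRoot s) (simpleRoot s) = 1 := by
  rw [form_simpleRoot, M.diagonal]
  simp

theorem form_comm (u v : B →₀ ℝ) : form M u v = form M v u := by
  have : form M = (form M).flip := by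
    ext s t
    simpa [form, simpleRoot] using by rw [M.symmetric]
  rw [this, LinearMap.flip_apply, ← this]

theorem form_simpleReflection (s : B) (u v : B →₀ ℝ) :
    form M (simpleReflection M s u) (simpleReflection M s v) = form M u v := by
  simp only [simpleReflection_apply, map_sub, map_smul, LinearMap.sub_apply, LinearMap.smul_apply,
    smul_eq_mul, form_simpleRoot_self]
  rw [form_comm M (simpleRoot s) v]
  ring

theorem simpleReflection_simpleRoot_self (s : B) :
    simpleReflection M s (simpleRoot s) = -simpleRoot s := by
  rw [simpleReflection_apply, form_simpleRoot_self]
  module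

theorem simpleReflection_simpleReflection (s : B) (v : B →₀ ℝ) :
    simpleReflection M s (simpleReflection M s v) = v :=
  Module.involutive_reflection (simpleCoroot_simpleRoot M s) v

theorem simpleReflection_apply_of_ne {s r : B} (h : r ≠ s) (v : B →₀ ℝ) :
    simpleReflection M s v r = v r := by
  rw [simpleReflection_apply]
  simp [simpleRoot, h.symm]

theorem form_simpleRoot_nonpos {s t : B} (h : s ≠ t) :
    form M (simpleRoot s) (simpleRoot t) ≤ 0 := by
  rw [form_simpleRoot, neg_nonpos]
  have h1 := M.off_diagonal s t h
  rcases Nat.eq_zero_or_pos (M s t) with h0 | h0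
  · simp [h0]
  have h2 : (2 : ℝ) ≤ M s t := by exact_mod_cast (by omega : 2 ≤ M s t)
  apply Real.cos_nonneg_of_mem_Icc
  have hpi := Real.pi_pos
  constructor
  · have : 0 ≤ Real.pi / (M s t : ℝ) := by positivity
    linarith
  · gcongr

theorem form_simpleRoot_neg {s t : B} (h : (diagram M).Adj s t) :
    form M (simpleRoot s) (simpleRoot t) < 0 := by
  rw [form_simpleRoot, neg_lt_zero]
  rcases h.2 with h3 | h0
  · have h3 : (3 : ℝ) ≤ M s t := by exact_mod_cast h3
    have hpi := Real.pi_pos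
    apply Real.cos_pos_of_mem_Ioo
    constructor
    · have : 0 ≤ Real.pi / (M s t : ℝ) := by positivity
      linarith
    · gcongr
      linarith
  · simp [h0]

theorem form_simpleRoot_eq_zero {s t : B} (hst : s ≠ t) (h : ¬ (diagram M).Adj s t) :
    form M (simpleRoot s) (simpleRoot t) = 0 := by
  have h1 := M.off_diagonal s t hst
  have h2 : M s t = 2 := by
    simp only [diagram, hst, ne_eq, not_false_eq_true, true_and, not_or] at h
    omega
  rw [form_simpleRoot, h2]
  simp

theorem mem_span_simpleRoot_iff {J : Set B} {v : B →₀ ℝ} :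
    v ∈ Submodule.span ℝ (simpleRoot '' J) ↔ ∀ s ∉ J, v s = 0 := by
  have : Submodule.span ℝ (simpleRoot '' J) = Finsupp.supported ℝ ℝ J :=
    (Finsupp.supported_eq_span_single ℝ J).symm
  rw [this, Finsupp.mem_supported']

theorem eq_sum_simpleRoot (v : B →₀ ℝ) : v = v.sum fun s a => a • simpleRoot s := by
  conv_lhs => rw [← v.sum_single]
  refine Finsupp.sum_congr fun s _ => ?_
  simp [simpleRoot]

theorem map_eq_sum_simpleRoot (f : (B →₀ ℝ) →ₗ[ℝ] ℝ) (v : B →₀ ℝ) :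
    f v = v.sum fun s a => a * f (simpleRoot s) := by
  conv_lhs => rw [eq_sum_simpleRoot v]
  simp [Finsupp.sum]

end Form

/-! ### Coefficients of roots in rank two -/

section Dihedral

/-- The Chebyshev-type sequence `0, 1, 2c, 4c² - 1, …`, equal to `sin (kθ) / sin θ` for
`c = cos θ`. -/
def dihedralCoeff (c : ℝ) : ℕ → ℝ
  | 0 => 0
  | 1 => 1
  | n + 2 => 2 * c * dihedralCoeff c (n + 1) - dihedralCoeff c n

theorem dihedralCoeff_mul_sin (θ : ℝ) (k : ℕ) :
    dihedralCoeff (Real.cos θ) k * Real.sin θ = Real.sin (k * θ) := by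
  induction k using Nat.twoStepInduction with
  | zero => simp [dihedralCoeff]
  | one => simp [dihedralCoeff]
  | more n h1 h2 =>
    rw [dihedralCoeff, sub_mul, mul_assoc, h2, h1]
    push_cast
    have e1 : ((n : ℝ) + 2) * θ = (n + 1) * θ + θ := by ring
    have e2 : (n : ℝ) * θ = (n + 1) * θ - θ := by ring
    rw [e1, e2, Real.sin_add, Real.sin_sub]
    ring

theorem dihedralCoeff_one (k : ℕ) : dihedralCoeff 1 k = k := by
  induction k using Nat.twoStepInduction with
  | zero => simp [dihedralCoeff]
  | one => simp [dihedralCoeff]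
  | more n h1 h2 =>
    rw [dihedralCoeff, h2, h1]
    push_cast
    ring

theorem dihedralCoeff_nonneg {m k : ℕ} (hm : m ≠ 1) (h : m ≠ 0 → k ≤ m) :
    0 ≤ dihedralCoeff (Real.cos (Real.pi / m)) k := by
  -- `m = 0` stands for ∞: the angle is then 0, its cosine 1, and the k-th coefficient is k.
  rcases eq_or_ne m 0 with rfl | h0
  · simp [dihedralCoeff_one]
  have hk : (k : ℝ) ≤ m := by exact_mod_cast h h0
  have h2 : (2 : ℝ) ≤ m := by exact_mod_cast (by omega : 2 ≤ m)
  have hpi := Real.pi_pos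
  have hsin : 0 < Real.sin (Real.pi / m) := by
    apply Real.sin_pos_of_pos_of_lt_pi
    · positivity
    · exact div_lt_self hpi (by linarith)
  refine nonneg_of_mul_nonneg_left ?_ hsin
  rw [dihedralCoeff_mul_sin]
  apply Real.sin_nonneg_of_nonneg_of_le_pi
  · positivity
  · rw [← mul_div_assoc, div_le_iff₀ (by linarith)]
    nlinarith

end Dihedral

/-! ### Roots are positive or negative -/

section Roots

variable {B : Type*} {M : CoxeterMatrix B} {W : Type*} [Group W] (cs : CoxeterSystem M W)

theorem geometricRep_mul_apply (w w' : W) (v : B →₀ ℝ) :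
    geometricRep cs (w * w') v = geometricRep cs w (geometricRep cs w' v) := by
  rw [map_mul]
  rfl

theorem geometricRep_inv_apply_self (w : W) (v : B →₀ ℝ) :
    geometricRep cs w⁻¹ (geometricRep cs w v) = v := by
  rw [← geometricRep_mul_apply, inv_mul_cancel, map_one]
  rfl

theorem geometricRep_apply_inv_self (w : W) (v : B →₀ ℝ) :
    geometricRep cs w (geometricRep cs w⁻¹ v) = v := by
  rw [← geometricRep_mul_apply, mul_inv_cancel, map_one]
  rfl

theorem form_geometricRep (w : W) (u v : B →₀ ℝ) :
    form M (geometricRep cs w u) (geometricRep cs w v) = form M u v := by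
  induction w using cs.simple_induction_left with
  | one => rw [map_one]; rfl
  | mul_simple_left w s ih =>
    rw [geometricRep_mul_apply, geometricRep_mul_apply, geometricRep_simple,
      form_simpleReflection, ih]

theorem geometricRep_alternatingWord (s t : B) (k : ℕ) :
    geometricRep cs (cs.wordProd (CoxeterSystem.alternatingWord s t k)) (simpleRoot s) =
      dihedralCoeff (Real.cos (Real.pi / M s t)) (k + 1) • simpleRoot (if Even k then s else t) +
      dihedralCoeff (Real.cos (Real.pi / M s t)) k • simpleRoot (if Even k then t else s) := by
  induction k with
  | zero => simp [CoxeterSystem.alternatingWord, dihedralCoeff]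
  | succ k ih =>
    rw [CoxeterSystem.alternatingWord_succ', cs.wordProd_cons, geometricRep_mul_apply, ih,
      geometricRep_simple, map_add, map_smul, map_smul, simpleReflection_simpleRoot_self,
      simpleReflection_apply, dihedralCoeff]
    by_cases hk : Even k
    · have hk' : ¬ Even (k + 1) := by simp [hk, parity_simps]
      simp only [hk, hk', if_true, if_false, form_simpleRoot]
      module
    · have hk' : Even (k + 1) := by simp [hk, parity_simps]
      simp only [hk, hk', if_true, if_false, form_simpleRoot]
      rw [M.symmetric t s]
      module

/-- If `ℓ(ws) > ℓ(w)` then `w(α_s)` has nonnegative coordinates. -/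
theorem geometricRep_simpleRoot_nonneg (w : W) (s : B)
    (hws : cs.length w < cs.length (w * cs.simple s)) (r : B) :
    0 ≤ geometricRep cs w (simpleRoot s) r := by
  classical
  induction hn : cs.length w using Nat.strong_induction_on generalizing w s with
  | _ n ih =>
  subst hn
  by_cases hw1 : w = 1
  · subst hw1
    rw [map_one]
    exact Finsupp.single_nonneg.2 zero_le_one r
  obtain ⟨t, ht⟩ := cs.exists_rightDescent_of_ne_one hw1
  have hst : s ≠ t := by
    rintro rfl
    exact absurd hws (not_lt.2 ht.le)
  -- Factor w = v·u with lengths adding, where u is the alternating word in s, t of length k ending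
  -- in the descent t, and take k maximal.
  let P : ℕ → Prop := fun k => ∃ v, w = v * cs.wordProd (CoxeterSystem.alternatingWord s t k) ∧
    cs.length v + k = cs.length w
  have hP1 : P 1 := by
    refine ⟨w * cs.simple t, ?_, cs.isRightDescent_iff.1 ht⟩
    simp [CoxeterSystem.alternatingWord]
  have hPle : ∀ k, P k → k ≤ cs.length w := by
    rintro k ⟨v, -, h⟩
    omega
  obtain ⟨k, hk1, ⟨v, hwv, hlen⟩, hmax⟩ : ∃ k, 1 ≤ k ∧ P k ∧ ¬ P (k + 1) := by
    refine ⟨Nat.findGreatest P (cs.length w), Nat.le_findGreatest (hPle 1 hP1) hP1,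
      Nat.findGreatest_spec (hPle 1 hP1) hP1, fun h => ?_⟩
    have := Nat.le_findGreatest (hPle _ h) h
    omega
  -- A descent of `v` at the letter that prolongs the word would contradict maximality of `k`.
  have hx : ¬ cs.IsRightDescent v (if Even k then t else s) := by
    intro h
    refine hmax ⟨v * cs.simple (if Even k then t else s), ?_, ?_⟩
    · rw [CoxeterSystem.alternatingWord_succ', cs.wordProd_cons, mul_assoc,
        cs.simple_mul_simple_cancel_left, hwv]
    · have := cs.isRightDescent_iff.1 h
      omega
  -- A descent at the first letter of the word would cancel it and shorten both factors, so `w`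
  -- would be too short.
  have hy : ¬ cs.IsRightDescent v (if Even k then s else t) := by
    intro h
    obtain ⟨j, rfl⟩ : ∃ j, k = j + 1 := ⟨k - 1, by omega⟩
    have e : (if Even (j + 1) then s else t) = if Even j then t else s := by
      by_cases hj : Even j <;> simp [hj, parity_simps]
    rw [e] at h
    have h1 := cs.isRightDescent_iff.1 h
    have h2 : w = v * cs.simple (if Even j then t else s) *
        cs.wordProd (CoxeterSystem.alternatingWord s t j) := by
      rw [hwv, CoxeterSystem.alternatingWord_succ', cs.wordProd_cons, mul_assoc]
    have h3 := cs.length_mul_le (v * cs.simple (if Even j then t else s))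
      (cs.wordProd (CoxeterSystem.alternatingWord s t j))
    have h4 := cs.length_wordProd_le (CoxeterSystem.alternatingWord s t j)
    rw [← h2] at h3
    rw [CoxeterSystem.length_alternatingWord] at h4
    omega
  -- Otherwise the word followed by `s` is not reduced, and then ws is no longer than w.
  have hkm : M s t ≠ 0 → k + 1 ≤ M s t := by
    intro h0
    by_contra hlt
    have hred := cs.not_isReduced_alternatingWord t s (m := k + 1)
      (by rwa [M.symmetric]) (by rw [M.symmetric]; omega)
    rw [CoxeterSystem.IsReduced, CoxeterSystem.alternatingWord_succ, cs.wordProd_concat,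
      List.length_concat, CoxeterSystem.length_alternatingWord] at hred
    have h1 := cs.length_mul_le v (cs.wordProd (CoxeterSystem.alternatingWord s t k))
    have h2 := cs.length_wordProd_le (CoxeterSystem.alternatingWord s t k)
    have h3 := cs.length_mul_simple (cs.wordProd (CoxeterSystem.alternatingWord s t k)) s
    have h4 := cs.length_mul_le v
      (cs.wordProd (CoxeterSystem.alternatingWord s t k) * cs.simple s)
    rw [← mul_assoc, ← hwv] at h4
    rw [← hwv] at h1
    rw [CoxeterSystem.length_alternatingWord] at h2
    omega
  have hv (z : B) (hz : ¬ cs.IsRightDescent v z) : 0 ≤ geometricRep cs v (simpleRoot z) r := by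
    refine ih (cs.length v) (by omega) v z ?_ rfl
    have := cs.not_isRightDescent_iff.1 hz
    omega
  have hm1 := M.off_diagonal s t hst
  rw [hwv, geometricRep_mul_apply, geometricRep_alternatingWord, map_add, map_smul,
    map_smul]
  exact add_nonneg (mul_nonneg (dihedralCoeff_nonneg hm1 hkm) (hv _ hy))
    (mul_nonneg (dihedralCoeff_nonneg hm1 fun h => by have := hkm h; omega) (hv _ hx))

variable {cs}

theorem simpleRoot_mem_roots (s : B) : simpleRoot s ∈ roots cs :=
  ⟨1, s, by rw [map_one]; rfl⟩

theorem simpleRoot_mem_posRoots (s : B) : simpleRoot s ∈ posRoots cs :=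
  ⟨simpleRoot_mem_roots s, fun r => Finsupp.single_nonneg.2 zero_le_one r⟩

theorem geometricRep_mem_roots {v : B →₀ ℝ} (hv : v ∈ roots cs) (w : W) :
    geometricRep cs w v ∈ roots cs := by
  obtain ⟨u, s, rfl⟩ := hv
  exact ⟨w * u, s, (geometricRep_mul_apply cs w u _).symm⟩

theorem neg_mem_roots {v : B →₀ ℝ} (hv : v ∈ roots cs) : -v ∈ roots cs := by
  obtain ⟨u, s, rfl⟩ := hv
  refine ⟨u * cs.simple s, s, ?_⟩
  rw [geometricRep_mul_apply, geometricRep_simple, simpleReflection_simpleRoot_self, map_neg]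

theorem form_self_of_mem_roots {v : B →₀ ℝ} (hv : v ∈ roots cs) : form M v v = 1 := by
  obtain ⟨u, s, rfl⟩ := hv
  rw [form_geometricRep, form_simpleRoot_self]

theorem ne_zero_of_mem_roots {v : B →₀ ℝ} (hv : v ∈ roots cs) : v ≠ 0 := by
  rintro rfl
  simpa using form_self_of_mem_roots hv

theorem zero_notMem_posRoots : (0 : B →₀ ℝ) ∉ posRoots cs := fun h => ne_zero_of_mem_roots h.1 rfl

/-- Every root is positive or negative. -/
theorem mem_posRoots_or_neg_mem_posRoots {v : B →₀ ℝ} (hv : v ∈ roots cs) :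
    v ∈ posRoots cs ∨ -v ∈ posRoots cs := by
  obtain ⟨w, s, rfl⟩ := id hv
  rcases cs.length_mul_simple w s with h | h
  · exact Or.inl ⟨hv, geometricRep_simpleRoot_nonneg cs w s (by omega)⟩
  · refine Or.inr ⟨neg_mem_roots hv, fun r => ?_⟩
    have := geometricRep_simpleRoot_nonneg cs (w * cs.simple s) s
      (by rw [cs.simple_mul_simple_cancel_right]; omega) r
    rwa [geometricRep_mul_apply, geometricRep_simple, simpleReflection_simpleRoot_self,
      map_neg] at this

theorem simpleReflection_mem_roots {v : B →₀ ℝ} (hv : v ∈ roots cs) (s : B) :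
    simpleReflection M s v ∈ roots cs := by
  rw [← geometricRep_simple cs]
  exact geometricRep_mem_roots hv _

/-- Roots have norm 1, so the only nonnegative multiple of a simple root that is a root is that
simple root. -/
theorem exists_ne_pos_of_mem_posRoots {v : B →₀ ℝ} (hv : v ∈ posRoots cs) {s : B}
    (hs : v ≠ simpleRoot s) : ∃ r, r ≠ s ∧ 0 < v r := by
  by_contra! h
  have hvs : v = v s • simpleRoot s := by
    ext r
    by_cases hr : r = s
    · subst hr
      simp [simpleRoot]
    · have := le_antisymm (h r hr) (hv.2 r)
      simp [simpleRoot, Ne.symm hr, this]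
  have h1 := form_self_of_mem_roots hv.1
  rw [hvs] at h1
  simp only [map_smul, LinearMap.smul_apply, form_simpleRoot_self, smul_eq_mul, mul_one] at h1
  have h2 := hv.2 s
  have h3 : v s = 1 := by nlinarith
  rw [h3, one_smul] at hvs
  exact hs hvs

/-- A simple reflection permutes the positive roots other than its own root. -/
theorem simpleReflection_mem_posRoots {v : B →₀ ℝ} (hv : v ∈ posRoots cs) {s : B}
    (hs : v ≠ simpleRoot s) : simpleReflection M s v ∈ posRoots cs := by
  obtain ⟨r, hrs, hr⟩ := exists_ne_pos_of_mem_posRoots hv hs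
  -- The reflection alters only the coordinate at `s`, so the positive coordinate at `r` survives
  -- and decides the sign.
  refine (mem_posRoots_or_neg_mem_posRoots (simpleReflection_mem_roots hv.1 s)).resolve_right ?_
  intro h
  have := h.2 r
  rw [Finsupp.neg_apply, simpleReflection_apply_of_ne M hrs] at this
  linarith

theorem simpleReflection_mem_span {K : Set B} {s : B} (hs : s ∈ K) {v : B →₀ ℝ}
    (hv : v ∈ Submodule.span ℝ (simpleRoot '' K)) :
    simpleReflection M s v ∈ Submodule.span ℝ (simpleRoot '' K) := by
  rw [simpleReflection_apply]
  exact sub_mem hv (Submodule.smul_mem _ _ (Submodule.subset_span (mem_image_of_mem _ hs)))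

theorem simpleReflection_mem_standardFlat {K : Set B} {s : B} (hs : s ∈ K) {v : B →₀ ℝ}
    (hv : v ∈ standardFlat cs K) (hne : v ≠ simpleRoot s) :
    simpleReflection M s v ∈ standardFlat cs K :=
  ⟨simpleReflection_mem_posRoots hv.1 hne, simpleReflection_mem_span hs hv.2⟩

theorem simpleRoot_mem_standardFlat_iff {K : Set B} {s : B} :
    simpleRoot s ∈ standardFlat cs K ↔ s ∈ K := by
  refine ⟨fun h => ?_, fun h => ⟨simpleRoot_mem_posRoots s,
    Submodule.subset_span (mem_image_of_mem _ h)⟩⟩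
  by_contra hn
  have := mem_span_simpleRoot_iff.1 h.2 s hn
  simp [simpleRoot] at this

theorem standardFlat_univ : standardFlat cs univ = posRoots cs := by
  ext v
  exact ⟨fun h => h.1, fun h => ⟨h, mem_span_simpleRoot_iff.2 fun s hs => absurd (mem_univ s) hs⟩⟩

/-! ### Functionals on positive roots and descent to the fundamental chamber -/

theorem map_nonneg_of_mem_standardFlat {K : Set B} {f : Module.Dual ℝ (B →₀ ℝ)}
    (hf : ∀ s ∈ K, 0 ≤ f (simpleRoot s)) {v : B →₀ ℝ} (hv : v ∈ standardFlat cs K) : 0 ≤ f v := by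
  rw [map_eq_sum_simpleRoot f v]
  refine Finset.sum_nonneg fun s hs => mul_nonneg (hv.1.2 s) (hf s ?_)
  by_contra hn
  exact Finsupp.mem_support_iff.1 hs (mem_span_simpleRoot_iff.1 hv.2 s hn)

theorem map_eq_zero_iff_of_mem_standardFlat {K : Set B} {f : Module.Dual ℝ (B →₀ ℝ)}
    (hf : ∀ s ∈ K, 0 ≤ f (simpleRoot s)) {v : B →₀ ℝ} (hv : v ∈ standardFlat cs K) :
    f v = 0 ↔ v ∈ Submodule.span ℝ (simpleRoot '' {s ∈ K | f (simpleRoot s) = 0}) := by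
  have hK : ∀ s ∉ K, v s = 0 := mem_span_simpleRoot_iff.1 hv.2
  constructor
  · intro h
    rw [map_eq_sum_simpleRoot f v, Finsupp.sum, Finset.sum_eq_zero_iff_of_nonneg] at h
    · refine mem_span_simpleRoot_iff.2 fun s hs => ?_
      by_contra hvs
      have hsK : s ∈ K := by
        by_contra hn
        exact hvs (hK s hn)
      exact hs ⟨hsK, (mul_eq_zero.1 (h s (Finsupp.mem_support_iff.2 hvs))).resolve_left hvs⟩
    · intro s hs
      refine mul_nonneg (hv.1.2 s) (hf s ?_)
      by_contra hn
      exact Finsupp.mem_support_iff.1 hs (hK s hn)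
  · intro h
    have : Submodule.span ℝ (simpleRoot '' {s ∈ K | f (simpleRoot s) = 0}) ≤ LinearMap.ker f :=
      Submodule.span_le.2 (by rintro _ ⟨s, hs, rfl⟩; exact hs.2)
    exact this h

/-- An induction principle for functionals which are negative on only finitely many roots of
`Φ_K⁺`: reduce to functionals in the fundamental chamber of `W_K`. -/
theorem induction_of_finite_neg {K : Set B} {P : Module.Dual ℝ (B →₀ ℝ) → Prop}
    (hdom : ∀ f, (∀ s ∈ K, 0 ≤ f (simpleRoot s)) → P f)
    (hstep : ∀ s ∈ K, ∀ f : Module.Dual ℝ (B →₀ ℝ), f (simpleRoot s) < 0 →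
      P (f.comp (simpleReflection M s : (B →₀ ℝ) →ₗ[ℝ] (B →₀ ℝ))) → P f)
    (f : Module.Dual ℝ (B →₀ ℝ)) (hfin : {v ∈ standardFlat cs K | f v < 0}.Finite) : P f := by
  induction hn : {v ∈ standardFlat cs K | f v < 0}.ncard using Nat.strong_induction_on
    generalizing f with
  | _ n ih =>
  subst hn
  by_cases h : ∀ s ∈ K, 0 ≤ f (simpleRoot s)
  · exact hdom f h
  push Not at h
  obtain ⟨s, hs, hfs⟩ := h
  set g := f.comp (simpleReflection M s : (B →₀ ℝ) →ₗ[ℝ] (B →₀ ℝ)) with hg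
  -- The reflection permutes the roots of Φ_K⁺ other than α_s, and α_s itself stops being negative,
  -- so the count drops.
  have hsub : {v ∈ standardFlat cs K | g v < 0} ⊆
      simpleReflection M s '' ({v ∈ standardFlat cs K | f v < 0} \ {simpleRoot s}) := by
    rintro v ⟨hv, hgv⟩
    have hgv' : f (simpleReflection M s v) < 0 := hgv
    have hne : v ≠ simpleRoot s := by
      rintro rfl
      rw [simpleReflection_simpleRoot_self, map_neg] at hgv'
      linarith
    refine ⟨simpleReflection M s v, ⟨⟨simpleReflection_mem_standardFlat hs hv hne, hgv'⟩, ?_⟩,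
      simpleReflection_simpleReflection M s v⟩
    intro h
    have h' := simpleReflection_simpleReflection M s v
    rw [mem_singleton_iff.1 h, simpleReflection_simpleRoot_self] at h'
    have := hv.1.2 s
    rw [← h'] at this
    norm_num [simpleRoot] at this
  have hfin' : (simpleReflection M s ''
      ({v ∈ standardFlat cs K | f v < 0} \ {simpleRoot s})).Finite :=
    (hfin.subset sdiff_subset).image _
  refine hstep s hs f hfs (ih _ ?_ g (hfin'.subset hsub) rfl)
  calc _ ≤ _ := ncard_le_ncard hsub hfin'
    _ ≤ _ := ncard_image_le (hfin.subset sdiff_subset)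
    _ < _ := ncard_sdiff_singleton_lt_of_mem ⟨simpleRoot_mem_standardFlat_iff.2 hs, hfs⟩ hfin

/-- Each simple reflection permutes all positive roots but one, so it adds at most one root to the
negative set. -/
theorem finite_neg_comp_geometricRep {f : Module.Dual ℝ (B →₀ ℝ)}
    (hf : {v ∈ posRoots cs | f v < 0}.Finite) (w : W) :
    {v ∈ posRoots cs | f (geometricRep cs w v) < 0}.Finite := by
  induction w using cs.simple_induction_right with
  | one => simpa using hf
  | mul_simple_right w s ih =>
    refine ((ih.image (simpleReflection M s)).insert (simpleRoot s)).subset ?_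
    rintro v ⟨hv, hfv⟩
    rw [geometricRep_mul_apply, geometricRep_simple] at hfv
    by_cases hne : v = simpleRoot s
    · exact Or.inl hne
    · exact Or.inr ⟨_, ⟨simpleReflection_mem_posRoots hv hne, hfv⟩,
        simpleReflection_simpleReflection M s v⟩

/-- Finiteness of the negative set is the only property of the Tits cone used to conjugate flats. -/
theorem finite_neg_of_mem_titsCone {f : Module.Dual ℝ (B →₀ ℝ)} (hf : f ∈ titsCone cs) :
    {v ∈ posRoots cs | f v < 0}.Finite := by
  obtain ⟨w, g, hg, hfg⟩ := hf
  simp only [hfg]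
  refine finite_neg_comp_geometricRep ?_ _
  convert finite_empty
  refine eq_empty_of_forall_notMem fun v hv => ?_
  exact absurd (map_nonneg_of_mem_standardFlat (cs := cs) (K := univ) (fun s _ => hg s)
    (by rw [standardFlat_univ]; exact hv.1)) (not_le.2 hv.2)

/-- A functional which is negative on finitely many roots of `Φ_K⁺` is moved into the
fundamental chamber of `W_K` by an element of `W_K`. -/
theorem exists_geometricRep_nonneg {K : Set B} {f : Module.Dual ℝ (B →₀ ℝ)}
    (hf : {v ∈ standardFlat cs K | f v < 0}.Finite) :
    ∃ u : W, (∀ v, geometricRep cs u⁻¹ v ∈ Submodule.span ℝ (simpleRoot '' K) ↔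
        v ∈ Submodule.span ℝ (simpleRoot '' K)) ∧
      ∀ s ∈ K, 0 ≤ f (geometricRep cs u (simpleRoot s)) := by
  refine induction_of_finite_neg (K := K) (P := fun f => ∃ u : W,
    (∀ v, geometricRep cs u⁻¹ v ∈ Submodule.span ℝ (simpleRoot '' K) ↔
        v ∈ Submodule.span ℝ (simpleRoot '' K)) ∧
      ∀ s ∈ K, 0 ≤ f (geometricRep cs u (simpleRoot s))) (fun f h => ?_)
    (fun s hs f hfs ih => ?_) f hf
  · refine ⟨1, fun v => ?_, fun s hs => ?_⟩
    · simp
    · simpa using h s hs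
  · obtain ⟨u, hu, hfu⟩ := ih
    refine ⟨cs.simple s * u, fun v => ?_, fun t ht => ?_⟩
    · rw [mul_inv_rev, cs.inv_simple, geometricRep_mul_apply, geometricRep_simple, hu]
      refine ⟨fun h => ?_, simpleReflection_mem_span hs⟩
      simpa [simpleReflection_simpleReflection] using
        simpleReflection_mem_span (M := M) hs h
    · rw [geometricRep_mul_apply, geometricRep_simple]
      exact hfu t ht

/-! ### Supports of positive roots -/

/-- If no edge of the diagram joins `A` to `K \ A`, every root of `Φ_K⁺` is supported
on one of these two sets. -/
theorem mem_span_or_mem_span_of_not_adj {K A : Set B}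
    (hAK : ∀ s ∈ A, ∀ t ∈ K \ A, ¬ (diagram M).Adj s t) {v : B →₀ ℝ}
    (hv : v ∈ standardFlat cs K) :
    v ∈ Submodule.span ℝ (simpleRoot '' A) ∨ v ∈ Submodule.span ℝ (simpleRoot '' (K \ A)) := by
  have hfix (C D : Set B) (hCD : ∀ s ∈ C, ∀ t ∈ D, s ≠ t ∧ ¬ (diagram M).Adj t s) (s : B)
      (hs : s ∈ C) : Submodule.span ℝ (simpleRoot '' D) ≤
        (Submodule.span ℝ (simpleRoot '' D)).comap
          (simpleReflection M s : (B →₀ ℝ) →ₗ[ℝ] (B →₀ ℝ)) := by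
    refine Submodule.span_le.2 ?_
    rintro _ ⟨t, ht, rfl⟩
    have h := hCD s hs t ht
    change simpleReflection M s (simpleRoot t) ∈ Submodule.span ℝ (simpleRoot '' D)
    rw [simpleReflection_apply, form_simpleRoot_eq_zero M h.1.symm h.2, mul_zero, zero_smul,
      sub_zero]
    exact Submodule.subset_span (mem_image_of_mem _ ht)
  have hinv (s : B) (hs : s ∈ K) (u : B →₀ ℝ)
      (hu : u ∈ Submodule.span ℝ (simpleRoot '' A) ∨
        u ∈ Submodule.span ℝ (simpleRoot '' (K \ A))) :
      simpleReflection M s u ∈ Submodule.span ℝ (simpleRoot '' A) ∨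
        simpleReflection M s u ∈ Submodule.span ℝ (simpleRoot '' (K \ A)) := by
    by_cases hsA : s ∈ A
    · exact hu.imp (fun h => simpleReflection_mem_span hsA h) fun h => hfix A (K \ A)
        (fun a ha b hb => ⟨fun e => hb.2 (e ▸ ha), fun h => hAK a ha b hb h.symm⟩) s hsA h
    · exact hu.imp (fun h => hfix (K \ A) A
        (fun a ha b hb => ⟨fun e => ha.2 (e ▸ hb), fun h => hAK b hb a ha h⟩) s ⟨hs, hsA⟩ h)
        (fun h => simpleReflection_mem_span (K := K \ A) ⟨hs, hsA⟩ h)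
  -- If v = w(α_s), the height functional composed with s·w⁻¹ takes the value -1 at v. The induction
  -- below then treats all roots of Φ_K⁺ negative for `f`, using only reflections from K; no
  -- expression of v as a W_K-conjugate of a simple root is needed.
  obtain ⟨f, hf, hfv⟩ : ∃ f : Module.Dual ℝ (B →₀ ℝ),
      {v ∈ standardFlat cs K | f v < 0}.Finite ∧ f v < 0 := by
    obtain ⟨w, s, hws⟩ := hv.1.1
    let ρ : Module.Dual ℝ (B →₀ ℝ) := Finsupp.linearCombination ℝ fun _ => 1
    have hρ (s : B) : ρ (simpleRoot s) = 1 := by simp [ρ, simpleRoot]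
    refine ⟨ρ.comp (geometricRep cs (cs.simple s * w⁻¹) : (B →₀ ℝ) →ₗ[ℝ] (B →₀ ℝ)), ?_, ?_⟩
    · refine (finite_neg_comp_geometricRep (cs := cs) (f := ρ) ?_ (cs.simple s * w⁻¹)).subset
        fun u hu => ⟨hu.1.1, hu.2⟩
      refine finite_neg_of_mem_titsCone ⟨1, ρ, fun t => by rw [hρ]; exact zero_le_one, fun u => ?_⟩
      simp
    · change ρ (geometricRep cs (cs.simple s * w⁻¹) v) < 0
      rw [hws, geometricRep_mul_apply, geometricRep_inv_apply_self, geometricRep_simple,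
        simpleReflection_simpleRoot_self, map_neg, hρ]
      norm_num
  refine induction_of_finite_neg (K := K) (P := fun f => ∀ v ∈ standardFlat cs K, f v < 0 →
    v ∈ Submodule.span ℝ (simpleRoot '' A) ∨ v ∈ Submodule.span ℝ (simpleRoot '' (K \ A)))
    (fun f h v hv hfv => absurd (map_nonneg_of_mem_standardFlat h hv) (not_le.2 hfv))
    (fun s hs f hfs ih v hv hfv => ?_) f hf v hv hfv
  · by_cases hvs : v = simpleRoot s
    · subst hvs
      by_cases hsA : s ∈ A
      · exact Or.inl (Submodule.subset_span (mem_image_of_mem _ hsA))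
      · exact Or.inr (Submodule.subset_span (mem_image_of_mem _ ⟨hs, hsA⟩))
    · have := hinv s hs _ (ih _ (simpleReflection_mem_standardFlat hs hv hvs) (by
        change f (simpleReflection M s (simpleReflection M s v)) < 0
        rwa [simpleReflection_simpleReflection]))
      rwa [simpleReflection_simpleReflection] at this

theorem form_simpleRoot_neg_of_mem_posRoots {v : B →₀ ℝ} (hv : v ∈ posRoots cs) {s t : B}
    (hs : v s = 0) (ht : v t ≠ 0) (hst : (diagram M).Adj t s) : form M v (simpleRoot s) < 0 := by
  have h := map_eq_sum_simpleRoot ((form M).flip (simpleRoot s)) v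
  rw [LinearMap.flip_apply] at h
  rw [h]
  refine Finset.sum_neg' (fun r hr => ?_) ⟨t, Finsupp.mem_support_iff.2 ht, ?_⟩
  · refine mul_nonpos_of_nonneg_of_nonpos (hv.2 r) (form_simpleRoot_nonpos M ?_)
    rintro rfl
    exact Finsupp.mem_support_iff.1 hr hs
  · exact mul_neg_of_pos_of_neg (lt_of_le_of_ne (hv.2 t) ht.symm) (form_simpleRoot_neg M hst)

/-- A connected subset of the diagram is the support of a positive root. -/
theorem exists_mem_posRoots_support_eq [Finite B] {K : Set B}
    (hK : ((diagram M).induce K).Connected) :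
    ∃ v ∈ posRoots cs, ∀ s, v s ≠ 0 ↔ s ∈ K := by
  obtain ⟨s₀, hs₀⟩ := hK.nonempty
  -- Take a positive root of maximal support inside K. If it missed a vertex, some edge of Γ_K would
  -- leave the support, and reflecting in its outer end would enlarge the support.
  obtain ⟨L, ⟨v, hv, hvK, rfl⟩, hmax⟩ := Set.Finite.exists_maximal
    (s := {L : Finset B | ∃ v ∈ posRoots cs, (∀ s, v s ≠ 0 → s ∈ K) ∧ v.support = L})
    (toFinite _) ⟨_, simpleRoot s₀, simpleRoot_mem_posRoots s₀, fun s hs => by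
      by_contra hn
      refine hs (Finsupp.single_eq_of_ne ?_)
      rintro rfl
      exact hn hs₀, rfl⟩
  refine ⟨v, hv, fun s => ⟨hvK s, fun hs hvs => ?_⟩⟩
  obtain ⟨t, ht⟩ : ∃ t, v t ≠ 0 := by
    by_contra! h
    exact ne_zero_of_mem_roots hv.1 (Finsupp.ext h)
  obtain ⟨p⟩ := hK.preconnected ⟨t, hvK t ht⟩ ⟨s, hs⟩
  obtain ⟨d, -, hd1, hd2⟩ := p.exists_boundary_dart {x | v x.1 ≠ 0} ht (by simpa using hvs)
  have hb : v d.snd.1 = 0 := by simpa using hd2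
  have hneg := form_simpleRoot_neg_of_mem_posRoots hv hb hd1 d.adj
  have hne : v ≠ simpleRoot d.snd.1 := by
    rintro h
    rw [h] at hb
    simp [simpleRoot] at hb
  have hval : simpleReflection M d.snd.1 v d.snd.1 ≠ 0 := by
    rw [simpleReflection_apply]
    rw [Finsupp.sub_apply, hb, Finsupp.smul_apply, simpleRoot, Finsupp.single_eq_same,
      smul_eq_mul, mul_one, zero_sub, neg_ne_zero]
    exact mul_ne_zero two_ne_zero hneg.ne
  have hle : v.support ≤ (simpleReflection M d.snd.1 v).support := by
    intro r hr
    rw [Finsupp.mem_support_iff] at hr ⊢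
    rwa [simpleReflection_apply_of_ne]
    rintro rfl
    exact hr hb
  have := hmax ⟨_, simpleReflection_mem_posRoots hv hne, fun r hr => ?_, rfl⟩ hle
    (Finsupp.mem_support_iff.2 hval)
  · exact Finsupp.mem_support_iff.1 this hb
  · by_cases hrd : r = d.snd.1
    · rw [hrd]
      exact d.snd.2
    · rw [simpleReflection_apply_of_ne M hrd] at hr
      exact hvK r hr

end Roots

/-! ### Standard flats: positivity, connectedness and circuitousness -/

section Flats

variable {B : Type*} {M : CoxeterMatrix B} {W : Type*} [Group W] {cs : CoxeterSystem M W}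

theorem span_standardFlat (J : Set B) :
    Submodule.span ℝ (standardFlat cs J) = Submodule.span ℝ (simpleRoot '' J) := by
  refine le_antisymm (Submodule.span_le.2 fun v hv => hv.2) (Submodule.span_mono ?_)
  rintro _ ⟨s, hs, rfl⟩
  exact simpleRoot_mem_standardFlat_iff.2 hs

theorem isFlat_standardFlat (J : Set B) : (rootMatroid cs).IsFlat (standardFlat cs J) := by
  refine isFlat_vectorMatroid_iff.2 ⟨fun v hv => hv.1, fun v hv h => ⟨hv, ?_⟩⟩
  rwa [span_standardFlat] at h

theorem standardFlat_injective : Function.Injective (standardFlat cs) := by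
  intro J J' h
  ext s
  rw [← simpleRoot_mem_standardFlat_iff (cs := cs), h, simpleRoot_mem_standardFlat_iff]

theorem isPositiveFlat_iff {F : Set (B →₀ ℝ)} :
    IsPositiveFlat cs F ↔ ∃ J, standardFlat cs J = F := by
  constructor
  · rintro ⟨-, X, ⟨f, rfl⟩, hX, rfl⟩
    have hf : ∀ s ∈ (univ : Set B), 0 ≤ f (simpleRoot s) := by
      intro s _
      rcases hX ⟨simpleRoot s, simpleRoot_mem_posRoots s⟩ with h | h
      · exact (sign_eq_one_iff.1 h).le
      · exact (sign_eq_zero_iff.1 h).ge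
    refine ⟨{s | s ∈ univ ∧ f (simpleRoot s) = 0}, ?_⟩
    have key (v : B →₀ ℝ) (hv : v ∈ posRoots cs) := map_eq_zero_iff_of_mem_standardFlat hf
      (v := v) (cs := cs) (by rwa [standardFlat_univ])
    ext v
    constructor
    · rintro ⟨hv, h⟩
      exact ⟨⟨v, hv⟩, sign_eq_zero_iff.2 ((key v hv).2 h), rfl⟩
    · rintro ⟨⟨v, hv⟩, h, rfl⟩
      exact ⟨hv, (key v hv).1 (sign_eq_zero_iff.1 h)⟩
  · rintro ⟨J, rfl⟩
    classical
    let f : Module.Dual ℝ (B →₀ ℝ) := Finsupp.linearCombination ℝ fun s => if s ∈ J then 0 else 1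
    have hfs (s : B) : f (simpleRoot s) = if s ∈ J then 0 else 1 := by simp [f, simpleRoot]
    have hf : ∀ s ∈ (univ : Set B), 0 ≤ f (simpleRoot s) := by
      intro s _
      rw [hfs]
      split_ifs <;> norm_num
    have hJ : {s | s ∈ univ ∧ f (simpleRoot s) = 0} = J := by
      ext s
      simp [hfs]
    have hmem (v : posRoots cs) : v.1 ∈ standardFlat cs univ := by
      rw [standardFlat_univ]
      exact v.2
    refine ⟨isFlat_standardFlat J, _, ⟨f, rfl⟩, fun v => ?_, ?_⟩
    · rcases (map_nonneg_of_mem_standardFlat hf (hmem v)).eq_or_lt with h | h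
      · exact Or.inr (sign_eq_zero_iff.2 h.symm)
      · exact Or.inl (sign_eq_one_iff.2 h)
    · ext v
      constructor
      · rintro ⟨hv, h⟩
        refine ⟨⟨v, hv⟩, sign_eq_zero_iff.2 ?_, rfl⟩
        rw [map_eq_zero_iff_of_mem_standardFlat hf (hmem ⟨v, hv⟩), hJ]
        exact h
      · rintro ⟨v, h, rfl⟩
        refine ⟨v.2, ?_⟩
        have := (map_eq_zero_iff_of_mem_standardFlat hf (hmem v)).1 (sign_eq_zero_iff.1 h)
        rwa [hJ] at this

/-- The coordinate functionals at t ∉ J lie in the fundamental chamber and already span the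
annihilator of Φ_J⁺. -/
theorem isParabolicFlat_standardFlat [Finite B] (J : Set B) :
    IsParabolicFlat cs (standardFlat cs J) := by
  refine ⟨isFlat_standardFlat J, le_antisymm (Submodule.span_le.2 fun f hf => hf.1) ?_⟩
  intro f hf
  have := Fintype.ofFinite B
  have hsum : f = ∑ t, f (simpleRoot t) • Finsupp.lapply (R := ℝ) t := by
    classical
    ext s
    simp [simpleRoot, Finsupp.single_apply]
  rw [hsum]
  refine Submodule.sum_mem _ fun t _ => ?_
  by_cases ht : t ∈ J
  · have : f (simpleRoot t) = 0 := (Submodule.mem_dualAnnihilator f).1 hf _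
      (Submodule.subset_span (simpleRoot_mem_standardFlat_iff.2 ht))
    rw [this, zero_smul]
    exact zero_mem _
  · refine Submodule.smul_mem _ _ (Submodule.subset_span ⟨?_, 1, Finsupp.lapply t, ?_, ?_⟩)
    · rw [flatSpace, span_standardFlat]
      exact (Submodule.mem_dualAnnihilator _).2 fun v hv => mem_span_simpleRoot_iff.1 hv t ht
    · exact fun s => (simpleRoot_mem_posRoots (cs := cs) s).2 t
    · simp

/-- If `Γ_K` is connected, then `Φ_K⁺` is indecomposable modulo every standard parabolic
subspace. -/
theorem indecomposableMod_standardFlat [Finite B] {K : Set B}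
    (hK : ((diagram M).induce K).Connected) (J : Set B) :
    IndecomposableMod (Submodule.span ℝ (simpleRoot '' J)) (standardFlat cs K) := by
  classical
  obtain ⟨v, hv, hvK⟩ := exists_mem_posRoots_support_eq (cs := cs) hK
  have hvmem : v ∈ standardFlat cs K := ⟨hv, mem_span_simpleRoot_iff.2 fun s hs => by
    by_contra h
    exact hs ((hvK s).1 h)⟩
  have key (U₁ U₂ : Submodule ℝ (B →₀ ℝ)) (h1 : Submodule.span ℝ (simpleRoot '' J) ≤ U₁)
      (h12 : U₁ ⊓ U₂ ≤ Submodule.span ℝ (simpleRoot '' J))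
      (hU : ∀ e ∈ standardFlat cs K, e ∈ U₁ ∨ e ∈ U₂) (hv1 : v ∈ U₁) :
      ∀ e ∈ standardFlat cs K, e ∈ U₁ := by
    let A : Set B := {s | simpleRoot s ∈ U₁}
    have hsp (s : B) (hs : s ∈ K) : simpleRoot s ∈ U₁ := by
      -- Split `v` into its coordinates in `A` and the rest. The rest lies in `U₂` termwise and in
      -- `U₁` as a difference, hence in the span of Δ_J; but its coordinate at `s` ∉ `J` is nonzero.
      by_contra hsU
      have hf1 : v.filter (· ∈ A) ∈ U₁ := by
        rw [eq_sum_simpleRoot (v.filter (· ∈ A))]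
        refine Submodule.sum_mem _ fun t ht => Submodule.smul_mem _ _ ?_
        rw [Finsupp.support_filter, Finset.mem_filter] at ht
        exact ht.2
      have hf2 : v.filter (fun t => ¬ t ∈ A) ∈ U₂ := by
        rw [eq_sum_simpleRoot (v.filter fun t => ¬ t ∈ A)]
        refine Submodule.sum_mem _ fun t ht => Submodule.smul_mem _ _ ?_
        rw [Finsupp.support_filter, Finset.mem_filter] at ht
        exact (hU _ (simpleRoot_mem_standardFlat_iff.2
          ((hvK t).1 (Finsupp.mem_support_iff.1 ht.1)))).resolve_left ht.2
      have hf3 : v.filter (fun t => ¬ t ∈ A) ∈ U₁ := by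
        have := Finsupp.filter_add_filter_not v (· ∈ A)
        rw [← eq_sub_iff_add_eq'] at this
        rw [this]
        exact sub_mem hv1 hf1
      have hsJ : s ∉ J := fun h => hsU (h1 (Submodule.subset_span (mem_image_of_mem _ h)))
      have h0 := mem_span_simpleRoot_iff.1 (h12 ⟨hf3, hf2⟩) s hsJ
      rw [Finsupp.filter_apply_pos (fun t => ¬ t ∈ A) _ hsU] at h0
      exact (hvK s).2 hs h0
    intro e he
    have : Submodule.span ℝ (simpleRoot '' K) ≤ U₁ :=
      Submodule.span_le.2 (by rintro _ ⟨s, hs, rfl⟩; exact hsp s hs)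
    exact this he.2
  intro U₁ U₂ h1 h2 h12 hU
  rcases hU v hvmem with h | h
  · exact Or.inl (key U₁ U₂ h1 h12 hU h)
  · exact Or.inr (key U₂ U₁ h2 (inf_comm U₁ U₂ ▸ h12) (fun e he => (hU e he).symm) h)

theorem connected_of_indecomposableMod {K : Set B} (hne : (standardFlat cs K).Nonempty)
    (h : IndecomposableMod ⊥ (standardFlat cs K)) : ((diagram M).induce K).Connected := by
  have hKne : K.Nonempty := by
    by_contra hn
    rw [not_nonempty_iff_eq_empty] at hn
    obtain ⟨v, hv⟩ := hne
    refine ne_zero_of_mem_roots hv.1.1 (Finsupp.ext fun s => ?_)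
    exact mem_span_simpleRoot_iff.1 hv.2 s (by simp [hn])
  have : Nonempty K := hKne.to_subtype
  refine ⟨fun x y => ?_⟩
  -- The component of `x` in Γ_K: with no edge leaving it, the roots of Φ_K⁺ split over `A` and `K \
  -- A`.
  let A : Set B := {s | ∃ hs : s ∈ K, ((diagram M).induce K).Reachable x ⟨s, hs⟩}
  have hAK : ∀ s ∈ A, ∀ t ∈ K \ A, ¬ (diagram M).Adj s t := by
    rintro s ⟨hs, hxs⟩ t ⟨ht, htA⟩ hst
    exact htA ⟨ht, hxs.trans (SimpleGraph.Adj.reachable (G := (diagram M).induce K)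
      (u := ⟨s, hs⟩) (v := ⟨t, ht⟩) hst)⟩
  have hxA : x.1 ∈ A := ⟨x.2, .refl _⟩
  have hmem (z : K) : simpleRoot z.1 ∈ standardFlat cs K := simpleRoot_mem_standardFlat_iff.2 z.2
  have hdisj : Submodule.span ℝ (simpleRoot '' A) ⊓ Submodule.span ℝ (simpleRoot '' (K \ A)) ≤
      ⊥ := by
    refine fun v hv => (Submodule.mem_bot ℝ).2 (Finsupp.ext fun s => ?_)
    by_cases hs : s ∈ A
    · exact mem_span_simpleRoot_iff.1 hv.2 s fun h => h.2 hs
    · exact mem_span_simpleRoot_iff.1 hv.1 s hs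
  rcases h (Submodule.span ℝ (simpleRoot '' A)) (Submodule.span ℝ (simpleRoot '' (K \ A)))
    bot_le bot_le hdisj
    (fun v hv => mem_span_or_mem_span_of_not_adj hAK hv) with h | h
  · have := (simpleRoot_mem_standardFlat_iff (cs := cs)).1
      ⟨simpleRoot_mem_posRoots y.1, h _ (hmem y)⟩
    exact this.2
  · have := (simpleRoot_mem_standardFlat_iff (cs := cs)).1
      ⟨simpleRoot_mem_posRoots x.1, h _ (hmem x)⟩
    exact absurd hxA this.2

theorem isConnectedFlat_standardFlat_iff [Finite B] {K : Set B} :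
    IsConnectedFlat cs (standardFlat cs K) ↔ ((diagram M).induce K).Connected := by
  constructor
  · intro h
    obtain ⟨hne, hind⟩ := MatroidConnected.indecomposableMod zero_notMem_posRoots
      (fun v hv => hv.1) h
    exact connected_of_indecomposableMod hne hind
  · intro hK
    obtain ⟨s, hs⟩ := hK.nonempty
    -- Connectedness of the flat itself is the case of contraction by the empty flat.
    have hflat : (vectorMatroid (posRoots cs)).IsFlat ∅ := by
      refine isFlat_vectorMatroid_iff.2 ⟨empty_subset _, fun v hv h => ?_⟩
      rw [Submodule.span_empty, Submodule.mem_bot] at h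
      exact absurd (h ▸ hv) zero_notMem_posRoots
    have := matroidConnected_restrict_contract (G := standardFlat cs K) hflat (fun v hv => hv.1)
      (empty_ssubset.2 ⟨_, simpleRoot_mem_standardFlat_iff.2 hs⟩)
      (by simpa using indecomposableMod_standardFlat (cs := cs) hK ∅)
    rwa [Matroid.contract_empty] at this

theorem closure_simpleRoot_image (J : Set B) :
    (rootMatroid cs).closure (simpleRoot '' J) = standardFlat cs J := by
  ext v
  exact mem_closure_vectorMatroid_iff (by rintro _ ⟨s, -, rfl⟩; exact simpleRoot_mem_posRoots s)

theorem linearIndepOn_range_simpleRoot :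
    LinearIndepOn ℝ id (range (simpleRoot : B → B →₀ ℝ)) :=
  (Finsupp.basisSingleOne (R := ℝ) (ι := B)).linearIndependent.linearIndepOn_id' (by
    ext v
    simp [simpleRoot])

theorem isBase_range_simpleRoot : (rootMatroid cs).IsBase (range simpleRoot) := by
  have hi : (rootMatroid cs).Indep (range simpleRoot) := vectorMatroid_indep_iff.2
    ⟨range_subset_iff.2 simpleRoot_mem_posRoots, linearIndepOn_range_simpleRoot⟩
  refine hi.isBase_of_ground_subset_closure ?_
  rw [← image_univ, closure_simpleRoot_image, standardFlat_univ]
  exact subset_rfl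

/-- The witness is a positive root with support J: its basic circuit must contain every simple root
of its support. It is not itself simple, because J has at least two elements. -/
theorem isCircuitousBase_range_simpleRoot [Finite B] :
    IsCircuitousBase (rootMatroid cs) (range simpleRoot) := by
  refine ⟨isBase_range_simpleRoot, fun I hI hnt hc => ?_⟩
  obtain ⟨J, rfl⟩ := subset_range_iff_exists_image_eq.1 hI
  rw [closure_simpleRoot_image] at hc ⊢
  obtain ⟨v, hv, hvJ⟩ := exists_mem_posRoots_support_eq (cs := cs)
    (isConnectedFlat_standardFlat_iff.1 hc)
  have hvspan : v ∈ Submodule.span ℝ (simpleRoot '' J) := mem_span_simpleRoot_iff.2 fun s hs => by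
    by_contra h
    exact hs ((hvJ s).1 h)
  have hvΔ : v ∉ range simpleRoot := by
    rintro ⟨s, rfl⟩
    obtain ⟨_, ⟨a, ha, rfl⟩, _, ⟨b, hb, rfl⟩, hab⟩ := hnt
    have hs (t : B) (ht : t ∈ J) : t = s := by
      by_contra hne
      exact (hvJ t).2 ht (Finsupp.single_eq_of_ne hne)
    exact hab (by rw [hs a ha, hs b hb])
  have hJΔ : (rootMatroid cs).Indep (simpleRoot '' J) :=
    isBase_range_simpleRoot.indep.subset (image_subset_range _ _)
  have hvJ' : v ∉ simpleRoot '' J := fun h => hvΔ (image_subset_range _ _ h)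
  have hdep : (rootMatroid cs).Dep (insert v (simpleRoot '' J)) := by
    rw [← hJΔ.mem_closure_iff_of_notMem hvJ', closure_simpleRoot_image]
    exact ⟨hv, hvspan⟩
  obtain ⟨C, hCss, hC⟩ := hdep.exists_isCircuit_subset
  have hCeq := hC.eq_fundCircuit_of_subset isBase_range_simpleRoot.indep
    (hCss.trans (insert_subset_insert (image_subset_range _ _)))
  refine ⟨v, ⟨hv, hvΔ⟩, ?_⟩
  rw [← hCeq]
  have hvC : v ∈ C := by
    by_contra h
    exact hC.not_indep (hJΔ.subset fun c hc => (hCss hc).resolve_left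
      fun hcv => h (hcv ▸ hc))
  have hCJ : C \ {v} ⊆ simpleRoot '' {s ∈ J | simpleRoot s ∈ C} := by
    rintro c ⟨hc, hcv⟩
    obtain ⟨s, hs, rfl⟩ := (hCss hc).resolve_left hcv
    exact ⟨s, ⟨hs, hc⟩, rfl⟩
  have hvC' : v ∈ Submodule.span ℝ (simpleRoot '' {s ∈ J | simpleRoot s ∈ C}) := by
    have h := hC.mem_closure_sdiff_singleton_of_mem hvC
    have := (rootMatroid cs).closure_subset_closure hCJ h
    rw [closure_simpleRoot_image] at this
    exact this.2
  have hJC : simpleRoot '' J ⊆ C := by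
    rintro _ ⟨s, hs, rfl⟩
    by_contra hn
    exact (hvJ s).2 hs (mem_span_simpleRoot_iff.1 hvC' s fun h => hn h.2)
  ext e
  rw [rootMatroid, mem_closure_vectorMatroid_iff (E := posRoots cs) hC.subset_ground]
  refine and_congr_right fun _ => ?_
  have : Submodule.span ℝ C = Submodule.span ℝ (simpleRoot '' J) := by
    refine le_antisymm (Submodule.span_le.2 fun c hc => ?_) (Submodule.span_mono hJC)
    rcases hCss hc with rfl | h
    · exact hvspan
    · exact Submodule.subset_span h
  rw [this]

end Flats

/-! ### Parabolic flats, their conjugation to standard ones, and quotients -/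

section Parabolic

variable {B : Type*} {M : CoxeterMatrix B} {W : Type*} [Group W] {cs : CoxeterSystem M W}

/-- Take f + εg with ε > 0 avoiding the finitely many ratios -f(v)/g(v) at roots where f or g is
negative. At all other positive roots both values are nonnegative, so they cannot cancel. -/
theorem exists_add_smul_of_finite_neg {X : Submodule ℝ (Module.Dual ℝ (B →₀ ℝ))}
    {f g : Module.Dual ℝ (B →₀ ℝ)} (hfX : f ∈ X) (hgX : g ∈ X)
    (hf : {v ∈ posRoots cs | f v < 0}.Finite) (hg : {v ∈ posRoots cs | g v < 0}.Finite) :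
    ∃ h ∈ X, {v ∈ posRoots cs | h v < 0}.Finite ∧
      ∀ v ∈ posRoots cs, h v = 0 → f v = 0 ∧ g v = 0 := by
  obtain ⟨ε, hε, hεn⟩ := (Ioi_infinite (0 : ℝ)).exists_notMem_finite
    ((hf.union hg).image fun v => -f v / g v)
  have hε : 0 < ε := hε
  refine ⟨f + ε • g, add_mem hfX (X.smul_mem _ hgX), (hf.union hg).subset ?_, fun v hv h => ?_⟩
  · rintro v ⟨hv, h⟩
    by_contra hn
    simp only [mem_union, mem_ofPred_eq, hv, true_and, not_or, not_lt] at hn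
    have : 0 ≤ f v + ε * g v := add_nonneg hn.1 (mul_nonneg hε.le hn.2)
    exact absurd h (not_lt.2 this)
  · have h : f v + ε * g v = 0 := h
    by_cases hn : v ∈ {v ∈ posRoots cs | f v < 0} ∪ {v ∈ posRoots cs | g v < 0}
    · by_cases hgv : g v = 0
      · exact ⟨by simpa [hgv] using h, hgv⟩
      · refine absurd ⟨v, hn, ?_⟩ hεn
        simp only
        rw [div_eq_iff hgv]
        linarith
    · simp only [mem_union, mem_ofPred_eq, hv, true_and, not_or, not_lt] at hn
      have h2 := mul_nonneg hε.le hn.2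
      have h3 : ε * g v = 0 := le_antisymm (by linarith [hn.1]) h2
      exact ⟨by linarith, (mul_eq_zero.1 h3).resolve_left hε.ne'⟩

/-- This merges the two cases: for finite W there are finitely many roots, so the finiteness
condition is void; for infinite W it holds on the Tits cone. -/
theorem span_flatSpace_inter_finite_neg {F : Set (B →₀ ℝ)} (hF : IsCoxeterFlat cs F) [Finite B] :
    Submodule.span ℝ {f | f ∈ flatSpace F ∧ {v ∈ posRoots cs | f v < 0}.Finite} = flatSpace F := by
  refine le_antisymm (Submodule.span_le.2 fun f hf => hf.1) ?_
  rcases finite_or_infinite W with hW | hW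
  · refine fun f hf => Submodule.subset_span ⟨hf, Finite.subset ?_ fun v hv => hv.1.1⟩
    refine (finite_range fun p : W × B => geometricRep cs p.1 (simpleRoot p.2)).subset ?_
    rintro v ⟨w, s, rfl⟩
    exact ⟨(w, s), rfl⟩
  · conv_lhs => rw [← (hF.2 hW).2]
    exact Submodule.span_mono fun f hf => ⟨hf.1, finite_neg_of_mem_titsCone hf.2⟩

/-- A flat under consideration is the zero set of a functional which is negative on only
finitely many positive roots. -/
theorem exists_functional_of_isCoxeterFlat [Finite B] {F : Set (B →₀ ℝ)}
    (hF : IsCoxeterFlat cs F) :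
    ∃ f ∈ flatSpace F, {v ∈ posRoots cs | f v < 0}.Finite ∧
      ∀ v ∈ posRoots cs, f v = 0 → v ∈ F := by
  have hfg : (Submodule.span ℝ {f | f ∈ flatSpace F ∧
      {v ∈ posRoots cs | f v < 0}.Finite}).FG := IsNoetherian.noetherian _
  obtain ⟨S, hS, hspan⟩ := Submodule.fg_span_iff_fg_span_finset_subset _ |>.1 hfg
  rw [span_flatSpace_inter_finite_neg hF] at hspan
  -- Combining a finite spanning set of X_F one functional at a time gives a single `h` whose zeros
  -- among the positive roots are killed by all of X_F, hence lie in the span of F.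
  have key : ∀ S : Finset (Module.Dual ℝ (B →₀ ℝ)),
      (S : Set _) ⊆ {f | f ∈ flatSpace F ∧ {v ∈ posRoots cs | f v < 0}.Finite} →
      ∃ h ∈ flatSpace F, {v ∈ posRoots cs | h v < 0}.Finite ∧
        ∀ v ∈ posRoots cs, h v = 0 → ∀ f ∈ S, f v = 0 := by
    classical
    intro S
    induction S using Finset.induction_on with
    | empty => exact fun _ => ⟨0, zero_mem _, by simp, by simp⟩
    | insert f S _ ih =>
      intro hS
      rw [Finset.coe_insert, insert_subset_iff] at hS
      obtain ⟨g, hgX, hg, hgS⟩ := ih hS.2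
      obtain ⟨h, hhX, hh, hhS⟩ := exists_add_smul_of_finite_neg hS.1.1 hgX hS.1.2 hg
      refine ⟨h, hhX, hh, fun v hv h0 => ?_⟩
      have := hhS v hv h0
      simpa [this.1] using hgS v hv this.2
  obtain ⟨h, hhX, hh, hhS⟩ := key S hS
  refine ⟨h, hhX, hh, fun v hv h0 => ?_⟩
  refine (isFlat_vectorMatroid_iff.1 hF.1).2 v hv ?_
  rw [← Subspace.forall_mem_dualAnnihilator_apply_eq_zero_iff]
  intro f hf
  have hf : f ∈ Submodule.span ℝ (S : Set (Module.Dual ℝ (B →₀ ℝ))) := hspan ▸ hf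
  have hle : Submodule.span ℝ (S : Set (Module.Dual ℝ (B →₀ ℝ))) ≤
      LinearMap.ker (Module.Dual.eval ℝ (B →₀ ℝ) v) :=
    Submodule.span_le.2 fun f hf => hhS v hv h0 f hf
  exact hle hf

variable (cs) in
/-- A subspace spanned by roots is parabolic if its roots are those on which some functional,
negative on only finitely many positive roots, vanishes. -/
def IsParabolicSubspace (P : Submodule ℝ (B →₀ ℝ)) : Prop :=
  P = Submodule.span ℝ (roots cs ∩ P) ∧ ∃ f : Module.Dual ℝ (B →₀ ℝ),
    {v ∈ posRoots cs | f v < 0}.Finite ∧ ∀ v ∈ roots cs, f v = 0 ↔ v ∈ P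

theorem IsCoxeterFlat.isParabolicSubspace_span [Finite B] {F : Set (B →₀ ℝ)}
    (hF : IsCoxeterFlat cs F) : IsParabolicSubspace cs (Submodule.span ℝ F) := by
  obtain ⟨f, hfX, hfin, hfF⟩ := exists_functional_of_isCoxeterFlat hF
  have hFE := (isFlat_vectorMatroid_iff.1 hF.1).1
  refine ⟨le_antisymm (Submodule.span_mono fun v hv => ⟨(hFE hv).1, Submodule.subset_span hv⟩)
    (Submodule.span_le.2 fun v hv => hv.2), f, hfin, fun v hv => ⟨fun h => ?_, fun h => ?_⟩⟩
  · rcases mem_posRoots_or_neg_mem_posRoots hv with h' | h'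
    · exact Submodule.subset_span (hfF v h' h)
    · exact neg_mem_iff.1 (Submodule.subset_span (hfF _ h' (by rw [map_neg, h, neg_zero])))
  · exact (Submodule.mem_dualAnnihilator f).1 hfX v h

theorem IsParabolicSubspace.map {P : Submodule ℝ (B →₀ ℝ)} (hP : IsParabolicSubspace cs P)
    (w : W) : IsParabolicSubspace cs
      (P.map (geometricRep cs w : (B →₀ ℝ) →ₗ[ℝ] (B →₀ ℝ))) := by
  obtain ⟨hspan, f, hfin, hf⟩ := hP
  refine ⟨le_antisymm ?_ (Submodule.span_le.2 fun v hv => hv.2),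
    f.comp (geometricRep cs w⁻¹ : (B →₀ ℝ) →ₗ[ℝ] (B →₀ ℝ)),
    finite_neg_comp_geometricRep hfin w⁻¹, fun v hv => ?_⟩
  · conv_lhs => rw [hspan]
    rw [Submodule.map_span]
    refine Submodule.span_mono ?_
    rintro _ ⟨v, hv, rfl⟩
    exact ⟨geometricRep_mem_roots hv.1 w, v, hv.2, rfl⟩
  · change f (geometricRep cs w⁻¹ v) = 0 ↔ _
    rw [hf _ (geometricRep_mem_roots hv _)]
    constructor
    · exact fun h => ⟨_, h, geometricRep_apply_inv_self cs w v⟩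
    · rintro ⟨u, hu, rfl⟩
      change geometricRep cs w⁻¹ (geometricRep cs w u) ∈ P
      rwa [geometricRep_inv_apply_self]

/-- A parabolic subspace inside the span of `Δ_K` is conjugate under `W_K` to the span of a
subset of `Δ_K`. -/
theorem IsParabolicSubspace.exists_map_eq_span {P : Submodule ℝ (B →₀ ℝ)}
    (hP : IsParabolicSubspace cs P) {K : Set B} (hPK : P ≤ Submodule.span ℝ (simpleRoot '' K)) :
    ∃ (w : W) (J : Set B),
      (Submodule.span ℝ (simpleRoot '' K)).map
        (geometricRep cs w : (B →₀ ℝ) →ₗ[ℝ] (B →₀ ℝ)) = Submodule.span ℝ (simpleRoot '' K) ∧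
      P.map (geometricRep cs w : (B →₀ ℝ) →ₗ[ℝ] (B →₀ ℝ)) =
        Submodule.span ℝ (simpleRoot '' J) := by
  obtain ⟨hspan, f, hfin, hf⟩ := hP
  obtain ⟨u, hu, hfu⟩ := exists_geometricRep_nonneg (cs := cs) (K := K) (f := f)
    (hfin.subset fun v hv => ⟨hv.1.1, hv.2⟩)
  let g : Module.Dual ℝ (B →₀ ℝ) := f.comp (geometricRep cs u : (B →₀ ℝ) →ₗ[ℝ] (B →₀ ℝ))
  -- Since `g` is nonnegative on Δ_K, its zeros among the roots in the span of Δ_K are spanned by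
  -- its zero simple roots.
  refine ⟨u⁻¹, {s ∈ K | g (simpleRoot s) = 0}, le_antisymm ?_ fun v hv => ?_, le_antisymm ?_ ?_⟩
  · rintro _ ⟨v, hv, rfl⟩
    exact (hu v).2 hv
  · refine ⟨geometricRep cs u v, (hu _).1 ?_, geometricRep_inv_apply_self cs u v⟩
    rwa [geometricRep_inv_apply_self]
  · rw [hspan, Submodule.map_span]
    refine Submodule.span_le.2 ?_
    rintro _ ⟨v, ⟨hv, hvP⟩, rfl⟩
    change geometricRep cs u⁻¹ v ∈ _
    have hr := geometricRep_mem_roots hv u⁻¹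
    have hK := (hu v).2 (hPK hvP)
    have hg : g (geometricRep cs u⁻¹ v) = 0 := by
      change f (geometricRep cs u (geometricRep cs u⁻¹ v)) = 0
      rw [geometricRep_apply_inv_self]
      exact (hf v hv).2 hvP
    rcases mem_posRoots_or_neg_mem_posRoots hr with h | h
    · exact (map_eq_zero_iff_of_mem_standardFlat hfu ⟨h, hK⟩).1 hg
    · exact neg_mem_iff.1 ((map_eq_zero_iff_of_mem_standardFlat hfu ⟨h, neg_mem hK⟩).1
        (by rw [map_neg]; exact neg_eq_zero.2 hg))
  · refine Submodule.span_le.2 ?_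
    rintro _ ⟨s, ⟨-, hs⟩, rfl⟩
    exact ⟨geometricRep cs u (simpleRoot s),
      (hf _ (geometricRep_mem_roots (simpleRoot_mem_roots s) u)).1 hs,
      geometricRep_inv_apply_self cs u _⟩

theorem mem_or_neg_mem_of_mem_span {F : Set (B →₀ ℝ)} (hF : (rootMatroid cs).IsFlat F)
    {v : B →₀ ℝ} (hv : v ∈ roots cs) (hvF : v ∈ Submodule.span ℝ F) : v ∈ F ∨ -v ∈ F :=
  (mem_posRoots_or_neg_mem_posRoots hv).imp
    (fun h => (isFlat_vectorMatroid_iff.1 hF).2 v h hvF)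
    (fun h => (isFlat_vectorMatroid_iff.1 hF).2 _ h (neg_mem hvF))

theorem map_map_geometricRep (w w' : W) (P : Submodule ℝ (B →₀ ℝ)) :
    (P.map (geometricRep cs w : (B →₀ ℝ) →ₗ[ℝ] (B →₀ ℝ))).map
      (geometricRep cs w' : (B →₀ ℝ) →ₗ[ℝ] (B →₀ ℝ)) =
    P.map (geometricRep cs (w' * w) : (B →₀ ℝ) →ₗ[ℝ] (B →₀ ℝ)) := by
  rw [← Submodule.map_comp, map_mul]
  rfl

/-- Nested parabolic subspaces are simultaneously conjugate to standard ones. -/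
theorem exists_map_eq_span_of_le {P Q : Submodule ℝ (B →₀ ℝ)} (hP : IsParabolicSubspace cs P)
    (hQ : IsParabolicSubspace cs Q) (hPQ : P ≤ Q) :
    ∃ (w : W) (J K : Set B),
      P.map (geometricRep cs w : (B →₀ ℝ) →ₗ[ℝ] (B →₀ ℝ)) =
        Submodule.span ℝ (simpleRoot '' J) ∧
      Q.map (geometricRep cs w : (B →₀ ℝ) →ₗ[ℝ] (B →₀ ℝ)) =
        Submodule.span ℝ (simpleRoot '' K) := by
  obtain ⟨w₁, K, -, hK⟩ := hQ.exists_map_eq_span (K := univ)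
    (fun v _ => mem_span_simpleRoot_iff.2 fun s hs => absurd (mem_univ s) hs)
  -- The second conjugation preserves the span of Δ_K, so it does not undo the first.
  obtain ⟨w₂, J, hK', hJ⟩ := (hP.map w₁).exists_map_eq_span (hK ▸ Submodule.map_mono hPQ)
  refine ⟨w₂ * w₁, J, K, ?_, ?_⟩
  · rw [← map_map_geometricRep, hJ]
  · rw [← map_map_geometricRep, hK, hK']

/-- Indecomposability travels both ways along the conjugation: from G to Φ_K⁺ to see that Γ_K is
connected, then back from Φ_K⁺ modulo Δ_J to G modulo F. -/
theorem matroidConnected_flatQuotient [Finite B] {F G : Set (B →₀ ℝ)} (hF : IsCoxeterFlat cs F)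
    (hG : IsCoxeterFlat cs G) (hFG : F ⊂ G) (hc : IsConnectedFlat cs G) :
    MatroidConnected (flatQuotient cs G F) := by
  have hGE : G ⊆ posRoots cs := (isFlat_vectorMatroid_iff.1 hG.1).1
  obtain ⟨w, J, K, hJ, hK⟩ := exists_map_eq_span_of_le hF.isParabolicSubspace_span
    hG.isParabolicSubspace_span (Submodule.span_mono hFG.1)
  set g := geometricRep cs w with hg
  have hgsymm (v : B →₀ ℝ) : g.symm v = geometricRep cs w⁻¹ v := by
    rw [LinearEquiv.symm_apply_eq, hg, geometricRep_apply_inv_self]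
  have hGK : ∀ v ∈ G, g v ∈ standardFlat cs K ∨ -g v ∈ standardFlat cs K := by
    intro v hv
    refine mem_or_neg_mem_of_mem_span (isFlat_standardFlat K)
      (geometricRep_mem_roots (hGE hv).1 w) ?_
    rw [span_standardFlat, ← hK]
    exact Submodule.mem_map_of_mem (Submodule.subset_span hv)
  have hKG : ∀ v ∈ standardFlat cs K, g.symm v ∈ G ∨ -g.symm v ∈ G := by
    intro v hv
    rw [hgsymm]
    refine mem_or_neg_mem_of_mem_span hG.1 (geometricRep_mem_roots hv.1.1 _) ?_
    obtain ⟨u, hu, huv⟩ : v ∈ (Submodule.span ℝ G).map (g : (B →₀ ℝ) →ₗ[ℝ] (B →₀ ℝ)) :=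
      hK ▸ hv.2
    rw [← huv]
    change geometricRep cs w⁻¹ (geometricRep cs w u) ∈ _
    rwa [geometricRep_inv_apply_self]
  obtain ⟨hne, hind⟩ := MatroidConnected.indecomposableMod zero_notMem_posRoots hGE hc
  have hKne : (standardFlat cs K).Nonempty := by
    obtain ⟨v, hv⟩ := hne
    exact (hGK v hv).elim (fun h => ⟨_, h⟩) fun h => ⟨_, h⟩
  have hKc : ((diagram M).induce K).Connected := by
    have := hind.of_equiv g hGK hKG
    rw [Submodule.map_bot] at this
    exact connected_of_indecomposableMod hKne this
  refine matroidConnected_restrict_contract hF.1 hGE hFG ?_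
  have h := (indecomposableMod_standardFlat (cs := cs) hKc J).of_equiv g.symm hKG
    (by simpa using hGK)
  rw [← hJ, ← Submodule.map_comp] at h
  simpa using h

end Parabolic

end CoxeterFlats

end

/-! ### Assembly of the four statements -/

open CoxeterFlats in
theorem mainTheorem4 {B : Type*} [Finite B] {M : CoxeterMatrix B} {W : Type*} [Group W]
    (cs : CoxeterSystem M W) :
    -- (i)
    (Set.BijOn (standardFlat cs) Set.univ {F | IsPositiveFlat cs F} ∧
      ∀ F, IsPositiveFlat cs F → IsCoxeterFlat cs F) ∧
    -- (ii)
    (Set.BijOn (standardFlat cs) {J | ((diagram M).induce J).Connected}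
        {F | IsPositiveFlat cs F ∧ IsConnectedFlat cs F} ∧
      Set.BijOn (standardFlat cs) {J | IsTube (diagram M) J}
        {F | IsPositiveFlat cs F ∧ IsConnectedFlat cs F ∧ F ≠ posRoots cs}) ∧
    -- (iii)
    IsCircuitousBase (rootMatroid cs) (Set.range simpleRoot) ∧
    -- (iv)
    (∀ F G, IsCoxeterFlat cs F → IsCoxeterFlat cs G → F ⊂ G → IsConnectedFlat cs G →
      MatroidConnected (flatQuotient cs G F)) := by
  refine ⟨⟨⟨fun J _ => isPositiveFlat_iff.2 ⟨J, rfl⟩, standardFlat_injective.injOn, ?_⟩, ?_⟩,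
    ⟨⟨fun J hJ => ?_, standardFlat_injective.injOn, ?_⟩,
      ⟨fun J hJ => ?_, standardFlat_injective.injOn, ?_⟩⟩,
    isCircuitousBase_range_simpleRoot, fun F G hF hG => matroidConnected_flatQuotient hF hG⟩
  · rintro F hF
    obtain ⟨J, rfl⟩ := isPositiveFlat_iff.1 hF
    exact ⟨J, Set.mem_univ J, rfl⟩
  · rintro F hF
    obtain ⟨J, rfl⟩ := isPositiveFlat_iff.1 hF
    exact ⟨isFlat_standardFlat J, fun _ => isParabolicFlat_standardFlat J⟩
  · exact ⟨isPositiveFlat_iff.2 ⟨J, rfl⟩, isConnectedFlat_standardFlat_iff.2 hJ⟩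
  · rintro F ⟨hF, hc⟩
    obtain ⟨J, rfl⟩ := isPositiveFlat_iff.1 hF
    exact ⟨J, isConnectedFlat_standardFlat_iff.1 hc, rfl⟩
  · refine ⟨isPositiveFlat_iff.2 ⟨J, rfl⟩, isConnectedFlat_standardFlat_iff.2 hJ.2.2, fun h => ?_⟩
    rw [← standardFlat_univ] at h
    exact hJ.1 (standardFlat_injective h)
  · rintro F ⟨hF, hc, hne⟩
    obtain ⟨J, rfl⟩ := isPositiveFlat_iff.1 hF
    have hJ := isConnectedFlat_standardFlat_iff.1 hc
    refine ⟨J, ⟨?_, Set.nonempty_coe_sort.1 hJ.nonempty, hJ⟩, rfl⟩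
    rintro rfl
    exact hne standardFlat_univ
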